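/- Let $X=\{X_u\}_{u\ge 0}$ and $Y=\{Y_u\}_{u\ge 0}$ be real-valued Lévy processes (a.s. càdlàg paths, stationary independent increments) with characteristic exponents $\Phi$ and $\Psi$, i.e. ${\mathbb E}[e^{iyX_u}\mid X_0=0]=e^{-u\Phi(y)}$ and ${\mathbb E}[e^{iyY_u}\mid Y_0=0]=e^{-u\Psi(y)}$ for all $u\ge 0$, $y\in\mathbb R$. A Lévy process may be started from any $x\in\mathbb R$, its law being that of $x$ plus the process started from $0$. Let $\hat Y_u=-Y_u$, and let $\mathcal F$ be the unitary Fourier transform on $L^2(\mathbb R)=L^2(\mathbb R,dx)$ (complex-valued functions), the continuous extension of $\mathcal Ff(z)=\frac1{\sqrt{2\pi}}\int_{\mathbb R}f(x)e^{-izx}\,dx$ from Schwartz functions. Let $s,t:[0,1]\to[0,\infty)$ be nondecreasing and right-continuous with $s(0)=t(0)=0$, and write $s(w-)$ for the left limit of $s$ at $w$. For $f\in L^2(\mathbb R)$ define, with Lebesgue–Stieltjes integrals in the exponents, $$F(x)={\mathbb E}\Big[e^{-\int_{(0,1]}\Psi(X_{s(w-)})\,dt(w)}f(X_{s(1)})\,\Big|\,X_0=x\Big],\qquad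 G(y)={\mathbb E}\Big[e^{-\int_{(0,1]}\Phi(\hat Y_{t(w)})\,ds(w)}\,\mathcal Ff(\hat Y_{t(1)})\,\Big|\,\hat Y_0=y\Big].$$ These are well defined as classes of functions: almost surely the integrals in the exponents converge absolutely for every starting point, the expectations converge absolutely for almost every $x$ (resp. $y$), and $F$ (resp. $G$) is the $L^2$-limit as $n\to\infty$ of the same expectations with $f$ (resp. $g=\mathcal Ff$) replaced by the truncation $f\mathbf 1_{\{|f|\le n\}}$ (resp. $g\mathbf 1_{\{|g|\le n\}}$), each of which lies in $L^2(\mathbb R)$. Then $F$ and $G$ are in $L^2(\mathbb R)$ and $G=\mathcal F F$ (as elements of $L^2(\mathbb R)$). -/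

import Mathlib

open MeasureTheory ProbabilityTheory Filter Set Topology
open scoped NNReal ENNReal unitInterval

/-- A real-valued Lévy process started at the origin. A Lévy process started at `x` is `x + X`. -/
structure IsLevyProcess {Ω : Type*} [MeasurableSpace Ω] (X : ℝ≥0 → Ω → ℝ) (P : Measure Ω) :
    Prop where
  measurable : ∀ u, Measurable (X u)
  start_zero : ∀ᵐ ω ∂P, X 0 ω = 0
  indep_increments : HasIndepIncrements X P
  stationary_increments : ∀ u v : ℝ≥0,
    IdentDistrib (fun ω => X (u + v) ω - X u ω) (fun ω => X v ω - X 0 ω) P P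
  cadlag : ∀ᵐ ω ∂P, ∀ u : ℝ≥0, ContinuousWithinAt (fun v => X v ω) (Ici u) u ∧
    ∃ l : ℝ, Tendsto (fun v => X v ω) (𝓝[<] u) (𝓝 l)

/-- `Φ` is the characteristic exponent of the process `X` (started at the origin). The identity for
all times `u` determines `Φ` uniquely. -/
def HasCharExponent {Ω : Type*} [MeasurableSpace Ω] (X : ℝ≥0 → Ω → ℝ) (P : Measure Ω)
    (Φ : ℝ → ℂ) : Prop :=
  ∀ (u : ℝ≥0) (y : ℝ),
    ∫ ω, Complex.exp (Complex.I * (y : ℂ) * (X u ω : ℂ)) ∂P = Complex.exp (-((u : ℝ) : ℂ) * Φ y)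

/-- A nondecreasing right-continuous function `[0,1] → [0,∞)` as a Stieltjes function. -/
def clockStieltjes (c : I → ℝ≥0) (hmono : Monotone c)
    (hright : ∀ w, ContinuousWithinAt c (Ici w) w) : StieltjesFunction I where
  toFun w := (c w : ℝ)
  mono' _ _ h := NNReal.coe_le_coe.2 (hmono h)
  right_continuous' w := NNReal.continuous_coe.continuousAt.comp_continuousWithinAt (hright w)

/-- The Lebesgue–Stieltjes measure `dc` on `[0,1]`: it gives `(a, b]` the mass `c b - c a`. -/
noncomputable def clockMeasure (c : I → ℝ≥0) (hmono : Monotone c)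
    (hright : ∀ w, ContinuousWithinAt c (Ici w) w) : Measure I :=
  (clockStieltjes c hmono hright).measure

/-- The random variable `∫_{(0,1]} ψ(x + Z_{a(w)}) μ(dw)`: the additive functional, along the clock
`a`, of the process `Z` started at `x`. -/
noncomputable def additiveFunctional {Ω : Type*} (ψ : ℝ → ℂ) (Z : ℝ≥0 → Ω → ℝ) (a : I → ℝ≥0)
    (μ : Measure I) (x : ℝ) (ω : Ω) : ℂ :=
  ∫ w in Ioc (0 : I) 1, ψ (x + Z (a w) ω) ∂μ

/-- `E[exp(-∫_{(0,1]} ψ(Z_{a(w)}) μ(dw)) f(Z_T) | Z_0 = x]`, the process started at `x` being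
`x + Z`. -/
noncomputable def weightedExpectation {Ω : Type*} [MeasurableSpace Ω] (P : Measure Ω)
    (ψ : ℝ → ℂ) (Z : ℝ≥0 → Ω → ℝ) (a : I → ℝ≥0) (μ : Measure I) (T : ℝ≥0) (f : ℝ → ℂ) (x : ℝ) :
    ℂ :=
  ∫ ω, Complex.exp (-additiveFunctional ψ Z a μ x ω) * f (x + Z T ω) ∂P

/-- `f` cut off to zero where `‖f‖ > n`. -/
noncomputable def truncate (f : ℝ → ℂ) (n : ℕ) : ℝ → ℂ :=
  {x | ‖f x‖ ≤ n}.indicator f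

/-- The expectation `E[exp(-∫_{(0,1]} ψ(Z_{a(w)}) μ(dw)) f(Z_T) | Z_0 = ·]` is well defined as a
class of functions: almost surely the integral in the exponent converges absolutely for every
starting point, for almost every starting point the expectation converges absolutely, and it is
the `L²` limit of the same expectations for the bounded truncations of `f`. -/
structure WellDefinedExpectation {Ω : Type*} [MeasurableSpace Ω] (P : Measure Ω)
    (ψ : ℝ → ℂ) (Z : ℝ≥0 → Ω → ℝ) (a : I → ℝ≥0) (μ : Measure I) (T : ℝ≥0) (f : ℝ → ℂ) :
    Prop where
  integrable_exponent : ∀ᵐ ω ∂P, ∀ x : ℝ,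
    IntegrableOn (fun w => ψ (x + Z (a w) ω)) (Ioc (0 : I) 1) μ
  integrable : ∀ᵐ x : ℝ, Integrable
    (fun ω => Complex.exp (-additiveFunctional ψ Z a μ x ω) * f (x + Z T ω)) P
  memLp_truncate : ∀ n, MemLp (weightedExpectation P ψ Z a μ T (truncate f n)) 2 volume
  tendsto_truncate : Tendsto
    (fun n => eLpNorm (fun x => weightedExpectation P ψ Z a μ T (truncate f n) x
      - weightedExpectation P ψ Z a μ T f x) 2 volume) atTop (𝓝 0)

/-- The unitary Fourier transform on `L²(ℝ)` with the normalization
`z ↦ (2π)^{-1/2} ∫ f(x) e^{-izx} dx`, obtained by rescaling Mathlib's `L²` Fourier transform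
(the continuous extension from Schwartz functions of `z ↦ ∫ f(x) e^{-2πizx} dx`). The value is a
function representing the resulting class. -/
noncomputable def fourierL2 (f : Lp ℂ 2 (volume : Measure ℝ)) (z : ℝ) : ℂ :=
  ((Real.sqrt (2 * Real.pi))⁻¹ : ℝ) *
    (FourierTransform.fourier f : Lp ℂ 2 (volume : Measure ℝ)) (z / (2 * Real.pi))

/-- On Schwartz functions `fourierL2` is given by the integral formula. -/
theorem fourierL2_schwartz (f : SchwartzMap ℝ ℂ) :
    ∀ᵐ z : ℝ, fourierL2 (f.toLp 2) z =
      ((Real.sqrt (2 * Real.pi))⁻¹ : ℝ) *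
        ∫ x : ℝ, f x * Complex.exp (-Complex.I * (z : ℂ) * (x : ℂ)) := by
  have hq : Measure.QuasiMeasurePreserving (fun z : ℝ => z / (2 * Real.pi)) volume volume := by
    refine ⟨by fun_prop, ?_⟩
    have h := Real.map_volume_mul_right (a := (2 * Real.pi)⁻¹) (by positivity)
    simp only [div_eq_mul_inv]
    rw [h]
    exact Measure.smul_absolutelyContinuous
  have h1 := hq.ae ((FourierTransform.fourier f).coeFn_toLp 2 (volume : Measure ℝ))
  filter_upwards [h1] with z hz
  unfold fourierL2
  rw [SchwartzMap.toLp_fourier_eq, hz, SchwartzMap.fourier_coe, Real.fourier_eq']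
  congr 1
  refine integral_congr_ae (Eventually.of_forall fun x => ?_)
  have hpi : (Real.pi : ℂ) ≠ 0 := by exact_mod_cast Real.pi_ne_zero
  simp only [smul_eq_mul, RCLike.inner_apply, conj_trivial]
  rw [mul_comm]
  congr 2
  push_cast
  field_simp

/-! The Fourier transform turns translations into modulations and conversely. Take `X` and `Y`
independent, on the product space, and sample both clocks on a finite grid. For frozen paths,
alternately translate `f` by the increments of `X` and multiply it by `exp(i x ΔY)`. The result is
one phase times a translate of `f`. Its Fourier transform is another phase times a translate of `g`,
and summation by parts identifies the new phase: it pairs `z - Y` at the right ends of the grid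
cells with `ΔX`, where the old one paired `x + X` at the left ends with `ΔY`. This is the source of
the asymmetry between `s(w-)` and `t(w)`.

Averaging over both processes commutes with the transform (`IsFourierPair.integral`). On the `f`
side the integral over `Y` is computed by independence of increments and gives the weight with `Ψ`;
on the `g` side the integral over `X` gives the weight with `Φ`. This is `isFourierPair_discrete`.

Refining the grid gives the general clocks. Left grid points produce `s(w-)`, right ones `t(w)`, and
a Lévy process is almost surely continuous at each fixed time (`IsLevyProcess.ae_continuousAt`), so
the sampled processes converge for almost every `w`. The exponents are continuous with nonnegative
real part, so the weights converge and are bounded by 1. Dominated convergence gives `L²`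
convergence on both sides (`tendsto_weightedExpectation`), and the graph of an isometry is closed.
-/

/-! ### The unitary Fourier transform on `L²` -/

theorem memLp_comp_div_two_pi {g : ℝ → ℂ} (hg : MemLp g 2 volume) :
    MemLp (fun z : ℝ => g (z / (2 * Real.pi))) 2 volume := by
  have hpos : (0 : ℝ) < 2 * Real.pi := by positivity
  have h := Real.map_volume_mul_right (a := (2 * Real.pi)⁻¹) (by positivity)
  have h1 : MemLp g 2 (Measure.map (fun x : ℝ => x * (2 * Real.pi)⁻¹) volume) := by
    rw [h]
    exact hg.smul_measure ENNReal.ofReal_ne_top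
  have h2 := h1.comp_of_map (by fun_prop)
  simpa only [div_eq_mul_inv, Function.comp_def] using h2

theorem ae_comp_div_two_pi {p : ℝ → Prop} (hp : ∀ᵐ x : ℝ, p x) :
    ∀ᵐ z : ℝ, p (z / (2 * Real.pi)) := by
  have hq : Measure.QuasiMeasurePreserving (fun z : ℝ => z / (2 * Real.pi)) volume volume := by
    refine ⟨by fun_prop, ?_⟩
    have h := Real.map_volume_mul_right (a := (2 * Real.pi)⁻¹) (by positivity)
    simp only [div_eq_mul_inv]
    rw [h]
    exact Measure.smul_absolutelyContinuous
  exact hq.ae hp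

theorem memLp_fourierL2 (f : Lp ℂ 2 (volume : Measure ℝ)) : MemLp (fourierL2 f) 2 volume := by
  unfold fourierL2
  exact (memLp_comp_div_two_pi (Lp.memLp _)).const_mul _

theorem eLpNorm_two_eq_sqrt_integral {f : ℝ → ℂ} (hf : MemLp f 2 volume) :
    eLpNorm f 2 volume =
      ENNReal.ofReal (Real.sqrt (∫ x, (starRingEnd ℂ) (f x) * f x).re) := by
  have e1 : ∫ x, (starRingEnd ℂ) (f x) * f x = inner ℂ (hf.toLp f) (hf.toLp f) := by
    rw [L2.inner_def]
    refine integral_congr_ae ?_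
    filter_upwards [hf.coeFn_toLp] with x h1
    rw [h1, RCLike.inner_apply, mul_comm]
  have e2 := norm_eq_sqrt_re_inner (𝕜 := ℂ) (hf.toLp f)
  rw [e1, ← RCLike.re_eq_complex_re, ← e2, Lp.norm_toLp, ENNReal.ofReal_toReal hf.2.ne]

/-- `f` and `g` are square integrable and `g` represents the unitary Fourier transform of `f`. -/
def IsFourierPair (f g : ℝ → ℂ) : Prop :=
  ∃ hf : MemLp f 2 (volume : Measure ℝ), g =ᵐ[volume] fourierL2 (hf.toLp f)

namespace IsFourierPair

variable {f g f₁ g₁ f₂ g₂ : ℝ → ℂ}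

theorem memLp_left (h : IsFourierPair f g) : MemLp f 2 volume := h.1

theorem memLp_right (h : IsFourierPair f g) : MemLp g 2 volume :=
  (memLp_congr_ae h.2).2 (memLp_fourierL2 _)

theorem of_memLp (hf : MemLp f 2 volume) : IsFourierPair f (fourierL2 (hf.toLp f)) :=
  ⟨hf, ae_eq_refl _⟩

theorem congr (h : IsFourierPair f₁ g₁) (hf : f₁ =ᵐ[volume] f₂) (hg : g₁ =ᵐ[volume] g₂) :
    IsFourierPair f₂ g₂ := by
  obtain ⟨h1, h2⟩ := h
  refine ⟨(memLp_congr_ae hf).1 h1, ?_⟩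
  rw [← MemLp.toLp_congr h1 _ hf]
  exact hg.symm.trans h2

theorem sub (h₁ : IsFourierPair f₁ g₁) (h₂ : IsFourierPair f₂ g₂) :
    IsFourierPair (f₁ - f₂) (g₁ - g₂) := by
  obtain ⟨a1, b1⟩ := h₁
  obtain ⟨a2, b2⟩ := h₂
  refine ⟨a1.sub a2, ?_⟩
  rw [MemLp.toLp_sub a1 a2]
  have key := ae_comp_div_two_pi (Lp.coeFn_sub (FourierTransform.fourier (a1.toLp f₁))
    (FourierTransform.fourier (a2.toLp f₂)))
  filter_upwards [b1, b2, key] with z h1 h2 h3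
  rw [Pi.sub_apply, h1, h2]
  unfold fourierL2
  have e : FourierTransform.fourier (a1.toLp f₁ - a2.toLp f₂) =
      FourierTransform.fourier (a1.toLp f₁) - FourierTransform.fourier (a2.toLp f₂) :=
    (Lp.fourierTransformₗᵢ ℝ ℂ).map_sub _ _
  rw [e, h3, Pi.sub_apply, mul_sub]

/-- Parseval's identity. -/
theorem integral_conj_mul (h₁ : IsFourierPair f₁ g₁) (h₂ : IsFourierPair f₂ g₂) :
    ∫ z, (starRingEnd ℂ) (g₁ z) * g₂ z = ∫ x, (starRingEnd ℂ) (f₁ x) * f₂ x := by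
  obtain ⟨a1, b1⟩ := h₁
  obtain ⟨a2, b2⟩ := h₂
  have e1 : ∫ x, (starRingEnd ℂ) (f₁ x) * f₂ x = inner ℂ (a1.toLp f₁) (a2.toLp f₂) := by
    rw [L2.inner_def]
    refine integral_congr_ae ?_
    filter_upwards [a1.coeFn_toLp, a2.coeFn_toLp] with x h1 h2
    rw [h1, h2, RCLike.inner_apply, mul_comm]
  rw [e1, ← Lp.inner_fourier_eq, L2.inner_def]
  set u := FourierTransform.fourier (a1.toLp f₁)
  set v := FourierTransform.fourier (a2.toLp f₂)
  have e2 : ∫ z, (starRingEnd ℂ) (g₁ z) * g₂ z =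
      ∫ z : ℝ, (((2 * Real.pi)⁻¹ : ℝ) : ℂ) *
        (fun y : ℝ => inner ℂ (u y) (v y)) (z / (2 * Real.pi)) := by
    refine integral_congr_ae ?_
    filter_upwards [b1, b2] with z h1 h2
    rw [h1, h2]
    simp only [fourierL2, map_mul, Complex.conj_ofReal, RCLike.inner_apply]
    have : ((Real.sqrt (2 * Real.pi))⁻¹ : ℝ) * ((Real.sqrt (2 * Real.pi))⁻¹ : ℝ)
        = (2 * Real.pi)⁻¹ := by
      rw [← mul_inv, Real.mul_self_sqrt (by positivity)]
    rw [← this]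
    push_cast
    ring
  rw [e2, integral_const_mul,
    Measure.integral_comp_div (fun y : ℝ => inner ℂ (u y) (v y)) (2 * Real.pi), abs_of_pos (by positivity),
    Complex.real_smul, ← mul_assoc, ← Complex.ofReal_mul, inv_mul_cancel₀ (by positivity)]
  simp

theorem eLpNorm_eq (h : IsFourierPair f g) : eLpNorm g 2 volume = eLpNorm f 2 volume := by
  rw [eLpNorm_two_eq_sqrt_integral h.memLp_left,
    eLpNorm_two_eq_sqrt_integral h.memLp_right, integral_conj_mul h h]

/-- Surjectivity, which lets Parseval's identity be tested against any square integrable function on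
the frequency side. The preimage is the inverse transform after undoing the rescaling by `2π`. -/
theorem exists_of_memLp (hg : MemLp g 2 volume) : ∃ f, IsFourierPair f g := by
  have hpos : (0 : ℝ) < 2 * Real.pi := by positivity
  have hk : MemLp (fun y : ℝ => ((Real.sqrt (2 * Real.pi) : ℝ) : ℂ) * g (y * (2 * Real.pi)))
      2 volume := by
    refine MemLp.const_mul ?_ _
    have h := Real.map_volume_mul_right (a := (2 * Real.pi)) hpos.ne'
    have h1 : MemLp g 2 (Measure.map (fun x : ℝ => x * (2 * Real.pi)) volume) := by
      rw [h]
      exact hg.smul_measure ENNReal.ofReal_ne_top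
    exact h1.comp_of_map (by fun_prop)
  let v := FourierTransformInv.fourierInv (hk.toLp _)
  refine ⟨v, Lp.memLp v, ?_⟩
  rw [Lp.toLp_coeFn]
  filter_upwards [ae_comp_div_two_pi hk.coeFn_toLp] with z hz
  unfold fourierL2
  rw [FourierTransform.fourier_fourierInv_eq, hz, div_mul_cancel₀ _ hpos.ne', ← mul_assoc,
    ← Complex.ofReal_mul, inv_mul_cancel₀ (Real.sqrt_pos.2 hpos).ne']
  simp

end IsFourierPair

theorem ae_eq_of_tendsto_eLpNorm {α : Type*} [MeasurableSpace α] {μ : Measure α}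
    {u : ℕ → α → ℂ} {v w : α → ℂ}
    (hu : ∀ n, AEStronglyMeasurable (u n) μ) (hv : AEStronglyMeasurable v μ)
    (hw : AEStronglyMeasurable w μ)
    (h₁ : Tendsto (fun n => eLpNorm (u n - v) 2 μ) atTop (𝓝 0))
    (h₂ : Tendsto (fun n => eLpNorm (u n - w) 2 μ) atTop (𝓝 0)) : v =ᵐ[μ] w := by
  have h3 : eLpNorm (v - w) 2 μ = 0 := by
    refine le_antisymm (ge_of_tendsto' (by simpa using h₁.add h₂) fun n => ?_) bot_le
    have : v - w = (u n - w) - (u n - v) := by abel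
    rw [this, add_comm]
    exact eLpNorm_sub_le ((hu n).sub hw) ((hu n).sub hv) (by norm_num)
  have h4 := (eLpNorm_eq_zero_iff (hv.sub hw) (by norm_num)).1 h3
  filter_upwards [h4] with x hx
  simpa [sub_eq_zero] using hx

/-- The graph of an isometry is closed: `v n` converges both to `g` and to the transform of `f`, and
`L²` limits are unique. -/
theorem IsFourierPair.of_tendsto {f g : ℝ → ℂ} {u v : ℕ → ℝ → ℂ}
    (h : ∀ n, IsFourierPair (u n) (v n)) (hf : MemLp f 2 volume)
    (hg : AEStronglyMeasurable g volume)
    (hu : Tendsto (fun n => eLpNorm (u n - f) 2 volume) atTop (𝓝 0))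
    (hv : Tendsto (fun n => eLpNorm (v n - g) 2 volume) atTop (𝓝 0)) : IsFourierPair f g := by
  refine ⟨hf, ?_⟩
  refine ae_eq_of_tendsto_eLpNorm (fun n => (h n).memLp_right.1) hg (memLp_fourierL2 _).1 hv ?_
  have := fun n => ((h n).sub (.of_memLp hf)).eLpNorm_eq
  simpa only [this] using hu

/-! ### Translations and modulations under the Fourier transform -/

theorem exists_schwartz_tendsto {f : ℝ → ℂ} (hf : MemLp f 2 volume) :
    ∃ φ : ℕ → SchwartzMap ℝ ℂ,
      Tendsto (fun n => eLpNorm (φ n - f : ℝ → ℂ) 2 volume) atTop (𝓝 0) := by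
  have hd := SchwartzMap.denseRange_toLpCLM (E := ℝ) (F := ℂ) (p := 2) (μ := volume)
    (by norm_num) (hf.toLp f)
  obtain ⟨x, hx, hlim⟩ := mem_closure_iff_seq_limit.1 hd
  choose φ hφ using hx
  refine ⟨φ, ?_⟩
  rw [Lp.tendsto_Lp_iff_tendsto_eLpNorm'] at hlim
  refine hlim.congr fun n => eLpNorm_congr_ae ?_
  rw [← hφ]
  have h1 := (φ n).coeFn_toLp 2 (volume : Measure ℝ)
  exact EventuallyEq.sub h1 hf.coeFn_toLp

theorem IsFourierPair.schwartz (φ : SchwartzMap ℝ ℂ) :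
    IsFourierPair φ (fun z => ((Real.sqrt (2 * Real.pi))⁻¹ : ℝ) *
      (FourierTransform.fourier φ) (z / (2 * Real.pi))) := by
  refine ⟨φ.memLp 2 volume, ?_⟩
  have h1 := ae_comp_div_two_pi
    ((FourierTransform.fourier φ).coeFn_toLp 2 (volume : Measure ℝ))
  filter_upwards [h1] with z hz
  have : (φ.memLp 2 volume).toLp φ = φ.toLp 2 := rfl
  unfold fourierL2
  rw [this, SchwartzMap.toLp_fourier_eq, hz]

theorem SchwartzMap.fourier_compSubConst (φ : SchwartzMap ℝ ℂ) (a ξ : ℝ) :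
    FourierTransform.fourier (φ.compSubConstCLM ℂ a) ξ =
      Complex.exp (((-(2 * Real.pi * a * ξ) : ℝ) : ℂ) * Complex.I) *
        FourierTransform.fourier φ ξ := by
  rw [SchwartzMap.fourier_coe, SchwartzMap.fourier_coe, Real.fourier_eq', Real.fourier_eq',
    ← integral_const_mul,
    ← integral_add_right_eq_self (μ := (volume : Measure ℝ)) _ a]
  refine integral_congr_ae (Eventually.of_forall fun x => ?_)
  simp only [SchwartzMap.compSubConstCLM_apply, add_sub_cancel_right, smul_eq_mul,
    RCLike.inner_apply, conj_trivial]
  conv_rhs => rw [← mul_assoc, ← Complex.exp_add]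
  congr 2
  push_cast
  ring

theorem SchwartzMap.fourierInv_compSubConst (φ : SchwartzMap ℝ ℂ) (a ξ : ℝ) :
    FourierTransformInv.fourierInv (φ.compSubConstCLM ℂ a) ξ =
      Complex.exp (((2 * Real.pi * a * ξ : ℝ) : ℂ) * Complex.I) *
        FourierTransformInv.fourierInv φ ξ := by
  rw [SchwartzMap.fourierInv_coe, SchwartzMap.fourierInv_coe, Real.fourierInv_eq',
    Real.fourierInv_eq', ← integral_const_mul,
    ← integral_add_right_eq_self (μ := (volume : Measure ℝ)) _ a]
  refine integral_congr_ae (Eventually.of_forall fun x => ?_)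
  simp only [SchwartzMap.compSubConstCLM_apply, add_sub_cancel_right, smul_eq_mul,
    RCLike.inner_apply, conj_trivial]
  conv_rhs => rw [← mul_assoc, ← Complex.exp_add]
  congr 2
  push_cast
  ring

theorem eLpNorm_comp_add_right (f : ℝ → ℂ) (hf : AEStronglyMeasurable f volume) (a : ℝ) :
    eLpNorm (fun x => f (x + a)) 2 volume = eLpNorm f 2 volume :=
  eLpNorm_comp_measurePreserving hf (measurePreserving_add_right volume a)

theorem eLpNorm_exp_mul (θ : ℝ → ℝ) (f : ℝ → ℂ) :
    eLpNorm (fun x => Complex.exp ((θ x : ℂ) * Complex.I) * f x) 2 volume =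
      eLpNorm f 2 volume := by
  refine eLpNorm_congr_norm_ae (Eventually.of_forall fun x => ?_)
  rw [norm_mul, Complex.norm_exp_ofReal_mul_I, one_mul]

/-- The isometry `f ↦ e^{iθ} f(· + a)` preserves `L²` convergence. -/
theorem tendsto_eLpNorm_exp_mul_comp_add {u : ℕ → ℝ → ℂ} {f : ℝ → ℂ} (θ : ℝ → ℝ) (a : ℝ)
    (hu : ∀ n, AEStronglyMeasurable (u n) volume) (hf : AEStronglyMeasurable f volume)
    (h : Tendsto (fun n => eLpNorm (u n - f) 2 volume) atTop (𝓝 0)) :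
    Tendsto (fun n => eLpNorm ((fun x => Complex.exp ((θ x : ℂ) * Complex.I) * u n (x + a)) -
      fun x => Complex.exp ((θ x : ℂ) * Complex.I) * f (x + a)) 2 volume) atTop (𝓝 0) := by
  refine h.congr fun n => ?_
  rw [← eLpNorm_comp_add_right _ ((hu n).sub hf) a, ← eLpNorm_exp_mul θ]
  congr 1
  ext x
  simp only [Pi.sub_apply]
  ring

theorem memLp_exp_mul_comp_add {f : ℝ → ℂ} (hf : MemLp f 2 volume) {θ : ℝ → ℝ}
    (hθ : Continuous θ) (a : ℝ) :
    MemLp (fun x => Complex.exp ((θ x : ℂ) * Complex.I) * f (x + a)) 2 volume := by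
  have h1 : MemLp (fun x => f (x + a)) 2 volume :=
    hf.comp_measurePreserving (measurePreserving_add_right volume a)
  refine ⟨AEStronglyMeasurable.mul (by fun_prop) h1.1, ?_⟩
  rw [eLpNorm_exp_mul]
  exact h1.2

/-- For Schwartz functions this is a change of variables. Translation and modulation are isometries
of `L²`, so density of Schwartz functions extends it. -/
theorem IsFourierPair.comp_add_right {f g : ℝ → ℂ} (h : IsFourierPair f g) (a : ℝ) :
    IsFourierPair (fun x => f (x + a))
      (fun z => Complex.exp (((a * z : ℝ) : ℂ) * Complex.I) * g z) := by
  have hS : ∀ φ : SchwartzMap ℝ ℂ, IsFourierPair (fun x => φ (x + a))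
      (fun z => Complex.exp (((a * z : ℝ) : ℂ) * Complex.I) * fourierL2 ((φ.memLp 2).toLp φ) z) := by
    intro φ
    refine (IsFourierPair.schwartz (φ.compSubConstCLM ℂ (-a))).congr ?_ ?_
    · exact Eventually.of_forall fun x => by simp [SchwartzMap.compSubConstCLM_apply]
    · filter_upwards [(IsFourierPair.schwartz φ).2] with z hz
      rw [← hz, SchwartzMap.fourier_compSubConst, mul_left_comm]
      congr 3
      push_cast
      have : (Real.pi : ℂ) ≠ 0 := by exact_mod_cast Real.pi_ne_zero
      field_simp
  obtain ⟨φ, hφ⟩ := exists_schwartz_tendsto h.memLp_left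
  have h0 := fun n => (φ n).memLp 2 (volume : Measure ℝ)
  have hφ' : Tendsto (fun n => eLpNorm (fourierL2 ((h0 n).toLp (φ n)) - g) 2 volume) atTop
      (𝓝 0) := by
    refine hφ.congr fun n => ?_
    exact (((IsFourierPair.of_memLp (h0 n)).sub h).eLpNorm_eq).symm
  refine IsFourierPair.of_tendsto (fun n => hS (φ n))
    (h.memLp_left.comp_measurePreserving (measurePreserving_add_right volume a))
    (AEStronglyMeasurable.mul (by fun_prop) h.memLp_right.1) ?_ ?_
  · simpa using tendsto_eLpNorm_exp_mul_comp_add 0 a (fun n => (h0 n).1) h.memLp_left.1 hφ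
  · simpa using tendsto_eLpNorm_exp_mul_comp_add (fun z => a * z) 0
      (fun n => (memLp_fourierL2 _).1) h.memLp_right.1 hφ'

theorem IsFourierPair.exp_mul {f g : ℝ → ℂ} (h : IsFourierPair f g) (b : ℝ) :
    IsFourierPair (fun x => Complex.exp (((b * x : ℝ) : ℂ) * Complex.I) * f x)
      (fun z => g (z - b)) := by
  have hS : ∀ φ : SchwartzMap ℝ ℂ, IsFourierPair
      (fun x => Complex.exp (((b * x : ℝ) : ℂ) * Complex.I) * φ x)
      (fun z => fourierL2 ((φ.memLp 2).toLp φ) (z - b)) := by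
    intro φ
    -- The modulated function is written as the inverse transform of a translated transform, so that
    -- it is visibly Schwartz and its transform is read off.
    refine (IsFourierPair.schwartz (FourierTransformInv.fourierInv
      ((FourierTransform.fourier φ).compSubConstCLM ℂ (b / (2 * Real.pi))))).congr ?_ ?_
    · refine Eventually.of_forall fun x => ?_
      simp only
      rw [SchwartzMap.fourierInv_compSubConst, FourierTransform.fourierInv_fourier_eq]
      congr 3
      push_cast
      have : (Real.pi : ℂ) ≠ 0 := by exact_mod_cast Real.pi_ne_zero
      field_simp
    · have := (measurePreserving_sub_right (volume : Measure ℝ) b).quasiMeasurePreserving.ae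
        (IsFourierPair.schwartz φ).2
      filter_upwards [this] with z hz
      rw [← hz, FourierTransform.fourier_fourierInv_eq, SchwartzMap.compSubConstCLM_apply, sub_div]
  obtain ⟨φ, hφ⟩ := exists_schwartz_tendsto h.memLp_left
  have h0 := fun n => (φ n).memLp 2 (volume : Measure ℝ)
  have hφ' : Tendsto (fun n => eLpNorm (fourierL2 ((h0 n).toLp (φ n)) - g) 2 volume) atTop
      (𝓝 0) := by
    refine hφ.congr fun n => ?_
    exact (((IsFourierPair.of_memLp (h0 n)).sub h).eLpNorm_eq).symm
  refine IsFourierPair.of_tendsto (fun n => hS (φ n)) ?_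
    (h.memLp_right.comp_measurePreserving (measurePreserving_sub_right volume b)).1 ?_ ?_
  · simpa using memLp_exp_mul_comp_add h.memLp_left (θ := fun x => b * x) (by fun_prop) 0
  · simpa using tendsto_eLpNorm_exp_mul_comp_add (fun z => b * z) 0
      (fun n => (h0 n).1) h.memLp_left.1 hφ
  · simpa [sub_eq_add_neg] using tendsto_eLpNorm_exp_mul_comp_add 0 (-b)
      (fun n => (memLp_fourierL2 _).1) h.memLp_right.1 hφ'

theorem IsFourierPair.const_mul {f g : ℝ → ℂ} (h : IsFourierPair f g) (c : ℂ) :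
    IsFourierPair (fun x => c * f x) (fun z => c * g z) := by
  obtain ⟨a1, b1⟩ := h
  refine ⟨a1.const_mul c, ?_⟩
  have e : (a1.const_mul c).toLp (fun x => c * f x) = c • a1.toLp f := rfl
  rw [e]
  have key := ae_comp_div_two_pi (Lp.coeFn_smul c (FourierTransform.fourier (a1.toLp f)))
  filter_upwards [b1, key] with z h1 h3
  rw [h1]
  unfold fourierL2
  rw [FourierTransform.fourier_smul, h3, Pi.smul_apply, smul_eq_mul, mul_left_comm]

theorem eLpNorm_two_eq_lintegral {α : Type*} [MeasurableSpace α] (μ : Measure α) (f : α → ℂ) :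
    eLpNorm f 2 μ = (∫⁻ x, ‖f x‖ₑ ^ (2 : ℝ) ∂μ) ^ (1 / 2 : ℝ) := by
  rw [eLpNorm_eq_lintegral_rpow_enorm_toReal (by norm_num) (by norm_num)]
  simp

/-! ### Averaging over a probability space -/

section Average

variable {Ω : Type*} [MeasurableSpace Ω] {P : Measure Ω} [IsProbabilityMeasure P]

theorem enorm_integral_rpow_two_le {f : Ω → ℂ} (hf : AEStronglyMeasurable f P) :
    ‖∫ ω, f ω ∂P‖ₑ ^ (2 : ℝ) ≤ ∫⁻ ω, ‖f ω‖ₑ ^ (2 : ℝ) ∂P := by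
  have h1 : ‖∫ ω, f ω ∂P‖ₑ ≤ eLpNorm f 2 P := by
    refine (enorm_integral_le_lintegral_enorm _).trans ?_
    rw [← eLpNorm_one_eq_lintegral_enorm]
    exact eLpNorm_le_eLpNorm_of_exponent_le (by norm_num) hf
  calc ‖∫ ω, f ω ∂P‖ₑ ^ (2 : ℝ) ≤ (eLpNorm f 2 P) ^ (2 : ℝ) := by gcongr
    _ = _ := by
      rw [eLpNorm_two_eq_lintegral, ← ENNReal.rpow_mul]
      norm_num

/-- Averaging over a probability space is a contraction of `L²`. -/
theorem eLpNorm_integral_le {h : ℝ × Ω → ℂ} (hh : AEStronglyMeasurable h (volume.prod P)) :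
    eLpNorm (fun x => ∫ ω, h (x, ω) ∂P) 2 volume ≤ eLpNorm h 2 (volume.prod P) := by
  rw [eLpNorm_two_eq_lintegral, eLpNorm_two_eq_lintegral,
    lintegral_prod _ (by fun_prop)]
  gcongr ?_ ^ _
  refine lintegral_mono_ae ?_
  filter_upwards [hh.prodMk_left] with x hx
  exact enorm_integral_rpow_two_le hx

theorem memLp_integral {h : ℝ × Ω → ℂ} (hh : MemLp h 2 (volume.prod P)) :
    MemLp (fun x => ∫ ω, h (x, ω) ∂P) 2 volume :=
  ⟨hh.1.integral_prod_right', (eLpNorm_integral_le hh.1).trans_lt hh.2⟩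

theorem tendsto_eLpNorm_integral {u : ℕ → ℝ × Ω → ℂ} {h : ℝ × Ω → ℂ}
    (hu : ∀ n, MemLp (u n) 2 (volume.prod P)) (hh : MemLp h 2 (volume.prod P))
    (hui : ∀ n, ∀ᵐ x : ℝ, Integrable (fun ω => u n (x, ω)) P)
    (hhi : ∀ᵐ x : ℝ, Integrable (fun ω => h (x, ω)) P)
    (hlim : Tendsto (fun n => eLpNorm (u n - h) 2 (volume.prod P)) atTop (𝓝 0)) :
    Tendsto (fun n => eLpNorm ((fun x => ∫ ω, u n (x, ω) ∂P) - fun x => ∫ ω, h (x, ω) ∂P) 2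
      volume) atTop (𝓝 0) := by
  refine tendsto_of_tendsto_of_tendsto_of_le_of_le tendsto_const_nhds hlim (fun _ => zero_le)
    fun n => ?_
  refine le_trans (le_of_eq ?_) (eLpNorm_integral_le ((hu n).1.sub hh.1))
  refine eLpNorm_congr_ae ?_
  filter_upwards [hui n, hhi] with x h1 h2
  simp only [Pi.sub_apply]
  rw [integral_sub h1 h2]

theorem MeasureTheory.MemLp.ae_integrable_slice {h : ℝ × Ω → ℂ}
    (hh : MemLp h 2 (volume.prod P)) : ∀ᵐ x : ℝ, Integrable (fun ω => h (x, ω)) P := by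
  have h2 := hh.2
  rw [eLpNorm_lt_top_iff_lintegral_rpow_enorm_lt_top (by norm_num) (by norm_num),
    lintegral_prod _ (by have := hh.1; fun_prop)] at h2
  have hm : AEMeasurable (fun x => ∫⁻ ω, ‖h (x, ω)‖ₑ ^ (2 : ℝ≥0∞).toReal ∂P) volume :=
    AEMeasurable.lintegral_prod_right'
      (f := fun p : ℝ × Ω => ‖h p‖ₑ ^ (2 : ℝ≥0∞).toReal) (by have := hh.1; fun_prop)
  filter_upwards [hh.1.prodMk_left, ae_lt_top' hm h2.ne] with x h3 h4
  have : MemLp (fun ω => h (x, ω)) 2 P := ⟨h3, by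
    rwa [eLpNorm_lt_top_iff_lintegral_rpow_enorm_lt_top (by norm_num) (by norm_num)]⟩
  exact this.integrable (by norm_num)

/-- For each frozen `ω` the map is a translation of Lebesgue measure. Hence `f (x + Z ω)` depends
only on the class of `f` and has the same `L²` norm on the product space. -/
theorem measurePreserving_add_randomVariable {Z : Ω → ℝ} (hZ : Measurable Z) :
    MeasurePreserving (fun p : ℝ × Ω => p.1 + Z p.2) (volume.prod P) volume := by
  have h1 : MeasurePreserving (fun p : Ω × ℝ => (p.1, p.2 + Z p.1)) (P.prod volume)
      (P.prod volume) := by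
    refine (MeasurePreserving.id P).skew_product (g := fun ω x => x + Z ω)
      (by simp only [Function.uncurry_def]; fun_prop) (Eventually.of_forall fun ω => ?_)
    exact (measurePreserving_add_right volume (Z ω)).map_eq
  exact (measurePreserving_snd (μ := P) (ν := (volume : Measure ℝ))).comp
    (h1.comp Measure.measurePreserving_swap)

theorem memLp_mul_comp_add {f : ℝ → ℂ} (hf : MemLp f 2 volume) {Z : Ω → ℝ} (hZ : Measurable Z)
    {e : ℝ × Ω → ℂ} (he : AEStronglyMeasurable e (volume.prod P))
    (hb : ∀ᵐ p ∂(volume.prod P), ‖e p‖ ≤ 1) :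
    MemLp (fun p => e p * f (p.1 + Z p.2)) 2 (volume.prod P) := by
  have h1 := hf.comp_measurePreserving (measurePreserving_add_randomVariable (P := P) hZ)
  refine h1.of_le (he.mul h1.1) ?_
  filter_upwards [hb] with p hp
  rw [norm_mul]
  exact mul_le_of_le_one_left (norm_nonneg _) hp

theorem integral_conj_mul_integral {φ : ℝ → ℂ} (hφ : MemLp φ 2 volume) {h : ℝ × Ω → ℂ}
    (hh : MemLp h 2 (volume.prod P)) :
    ∫ x, (starRingEnd ℂ) (φ x) * ∫ ω, h (x, ω) ∂P =
      ∫ ω, (∫ x, (starRingEnd ℂ) (φ x) * h (x, ω)) ∂P := by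
  have h1 : MemLp (fun p : ℝ × Ω => (starRingEnd ℂ) (φ p.1)) 2 (volume.prod P) :=
    (hφ.star).comp_measurePreserving measurePreserving_fst
  have h2 : Integrable (fun p : ℝ × Ω => (starRingEnd ℂ) (φ p.1) * h p) (volume.prod P) :=
    h1.integrable_mul hh
  simp only [← integral_const_mul]
  exact integral_integral_swap (f := fun x ω => (starRingEnd ℂ) (φ x) * h (x, ω)) h2

/-- The Fourier transform commutes with averaging over a probability space. -/
theorem IsFourierPair.integral {f g : ℝ × Ω → ℂ} (hf : MemLp f 2 (volume.prod P))
    (hg : MemLp g 2 (volume.prod P))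
    (h : ∀ᵐ ω ∂P, IsFourierPair (fun x => f (x, ω)) (fun z => g (z, ω))) :
    IsFourierPair (fun x => ∫ ω, f (x, ω) ∂P) (fun z => ∫ ω, g (z, ω) ∂P) := by
  have hEf := memLp_integral hf
  have hEg := memLp_integral hg
  have hk := IsFourierPair.of_memLp hEf
  set k := fourierL2 (hEf.toLp _) with hkdef
  have hD := hEg.sub hk.memLp_right
  -- Weak argument: `ψ` has transform `D`, the difference between the average of `g` and the
  -- transform of the average of `f`. Fubini and Parseval for each `ω` show that `D` pairs equally
  -- with both, so `D` has norm zero.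
  obtain ⟨ψ, hψ⟩ := IsFourierPair.exists_of_memLp hD
  set D := (fun z => ∫ ω, g (z, ω) ∂P) - k with hDdef
  have e1 : ∫ z, (starRingEnd ℂ) (D z) * ∫ ω, g (z, ω) ∂P =
      ∫ z, (starRingEnd ℂ) (D z) * k z := by
    rw [hψ.integral_conj_mul hk, integral_conj_mul_integral hD hg,
      integral_conj_mul_integral hψ.memLp_left hf]
    refine integral_congr_ae ?_
    filter_upwards [h] with ω hω
    exact hψ.integral_conj_mul hω
  have i1 : Integrable (fun z => (starRingEnd ℂ) (D z) * ∫ ω, g (z, ω) ∂P) volume :=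
    (hD.star).integrable_mul hEg
  have i2 : Integrable (fun z => (starRingEnd ℂ) (D z) * k z) volume :=
    (hD.star).integrable_mul hk.memLp_right
  have e2 : ∫ z, (starRingEnd ℂ) (D z) * D z = 0 := by
    have : ∀ z, (starRingEnd ℂ) (D z) * D z =
        (starRingEnd ℂ) (D z) * (∫ ω, g (z, ω) ∂P) - (starRingEnd ℂ) (D z) * k z := by
      intro z
      rw [← mul_sub, hDdef, Pi.sub_apply]
    simp only [this]
    rw [integral_sub i1 i2, e1, sub_self]
  have e3 := eLpNorm_two_eq_sqrt_integral hD
  rw [e2] at e3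
  have e4 := (eLpNorm_eq_zero_iff hD.1 two_ne_zero).1 (by simpa using e3)
  refine hk.congr (ae_eq_refl _) ?_
  filter_upwards [e4] with z hz
  rw [hDdef, Pi.sub_apply, Pi.zero_apply, sub_eq_zero] at hz
  exact hz.symm

end Average

/-- Dominated convergence for the squared norms, with majorant `(2 ‖h‖)²`. -/
theorem tendsto_eLpNorm_mul_of_bounded {α : Type*} [MeasurableSpace α] {μ : Measure α}
    {e : ℕ → α → ℂ} {e' h : α → ℂ} (he : ∀ n, AEStronglyMeasurable (e n) μ)
    (hb : ∀ n, ∀ᵐ p ∂μ, ‖e n p‖ ≤ 1) (hlim : ∀ᵐ p ∂μ, Tendsto (fun n => e n p) atTop (𝓝 (e' p)))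
    (hh : MemLp h 2 μ) :
    Tendsto (fun n => eLpNorm ((fun p => e n p * h p) - fun p => e' p * h p) 2 μ) atTop
      (𝓝 0) := by
  have he' : AEStronglyMeasurable e' μ := aestronglyMeasurable_of_tendsto_ae atTop he hlim
  have hb' : ∀ᵐ p ∂μ, ‖e' p‖ ≤ 1 := by
    filter_upwards [ae_all_iff.2 hb, hlim] with p h1 h2
    exact le_of_tendsto' h2.norm h1
  simp only [eLpNorm_two_eq_lintegral]
  have h2 := hh.2
  rw [eLpNorm_lt_top_iff_lintegral_rpow_enorm_lt_top (by norm_num) (by norm_num)] at h2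
  have key : Tendsto (fun n => ∫⁻ p, ‖((fun p => e n p * h p) - fun p => e' p * h p) p‖ₑ ^ (2 : ℝ) ∂μ)
      atTop (𝓝 (∫⁻ _, 0 ∂μ)) := by
    refine tendsto_lintegral_of_dominated_convergence' (fun p => (2 * ‖h p‖ₑ) ^ (2 : ℝ)) ?_ ?_ ?_ ?_
    · intro n
      have := he n
      have := hh.1
      have := (((he n).mul hh.1).sub (he'.mul hh.1)).enorm
      exact this.pow_const _
    · intro n
      filter_upwards [hb n, hb'] with p h3 h4
      simp only [Pi.sub_apply]
      gcongr
      rw [← sub_mul, enorm_mul]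
      gcongr
      refine enorm_sub_le.trans ?_
      rw [← one_add_one_eq_two]
      gcongr
      · exact (ofReal_norm _).symm.trans_le (ENNReal.ofReal_le_one.2 h3)
      · exact (ofReal_norm _).symm.trans_le (ENNReal.ofReal_le_one.2 h4)
    · simp only [ENNReal.mul_rpow_of_nonneg _ _ (zero_le_two : (0 : ℝ) ≤ 2)]
      rw [lintegral_const_mul' _ _ (by norm_num)]
      exact ENNReal.mul_ne_top (by norm_num) (by simpa using h2.ne)
    · filter_upwards [hlim] with p hp
      have h5 : Tendsto (fun n => e n p * h p - e' p * h p) atTop (𝓝 0) := by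
        simpa using (hp.mul_const (h p)).sub_const (e' p * h p)
      have h6 := (ENNReal.continuous_rpow_const (y := 2)).continuousAt.tendsto.comp
        (continuous_enorm.continuousAt.tendsto.comp h5)
      simpa [Function.comp_def] using h6
  simp only [lintegral_zero] at key
  have h7 := (ENNReal.continuous_rpow_const (y := (1 / 2 : ℝ))).continuousAt.tendsto.comp key
  simpa [Function.comp_def] using h7

/-! ### Characteristic exponents and continuity at fixed times -/

section Exponent

variable {Ω : Type*} [MeasurableSpace Ω] {X : ℝ≥0 → Ω → ℝ} {P : Measure Ω}
  {Φ : ℝ → ℂ}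

theorem norm_exp_I_mul (y x : ℝ) : ‖Complex.exp (Complex.I * (y : ℂ) * (x : ℂ))‖ = 1 := by
  have : Complex.I * (y : ℂ) * (x : ℂ) = ((y * x : ℝ) : ℂ) * Complex.I := by push_cast; ring
  rw [this, Complex.norm_exp_ofReal_mul_I]

theorem HasCharExponent.norm_exp_le_one [IsProbabilityMeasure P] (h : HasCharExponent X P Φ) (u : ℝ≥0) (y : ℝ) :
    ‖Complex.exp (-((u : ℝ) : ℂ) * Φ y)‖ ≤ 1 := by
  rw [← h u y]
  refine (norm_integral_le_integral_norm _).trans ?_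
  simp [norm_exp_I_mul]

theorem HasCharExponent.re_nonneg [IsProbabilityMeasure P] (h : HasCharExponent X P Φ) (y : ℝ) : 0 ≤ (Φ y).re := by
  have := h.norm_exp_le_one 1 y
  rw [Complex.norm_exp, Real.exp_le_one_iff] at this
  simpa using this

theorem HasCharExponent.continuous_exp [IsProbabilityMeasure P] (h : HasCharExponent X P Φ) (hX : ∀ u, Measurable (X u))
    (u : ℝ≥0) : Continuous fun y => Complex.exp (-((u : ℝ) : ℂ) * Φ y) := by
  simp only [← h u]
  refine continuous_of_dominated (bound := fun _ => 1) ?_ ?_ (integrable_const _) ?_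
  · intro y
    have := hX u
    exact Measurable.aestronglyMeasurable (by fun_prop)
  · exact fun y => Eventually.of_forall fun ω => (norm_exp_I_mul y _).le
  · exact Eventually.of_forall fun ω => by fun_prop

/-- Continuity of `exp (-u Φ)` at one time does not determine a continuous branch of the logarithm,
so all small times are used. With `J y = ∫₀^δ exp (-v Φ y) dv` one has `J Φ = 1 - exp (-δ Φ)`. Both
`J` and the right side are continuous, and `J y₀ ≠ 0` when `δ` keeps the integrand within `1/2` of 1
at `y₀`. -/
theorem HasCharExponent.continuous [IsProbabilityMeasure P] (h : HasCharExponent X P Φ) (hX : ∀ u, Measurable (X u)) :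
    Continuous Φ := by
  rw [continuous_iff_continuousAt]
  intro y₀
  obtain ⟨δ, hδ, hδ'⟩ : ∃ δ : ℝ≥0, 0 < δ ∧ ∀ v : ℝ, 0 ≤ v → v ≤ δ →
      ‖Complex.exp (-(v : ℂ) * Φ y₀) - 1‖ ≤ 1 / 2 := by
    have hc : ContinuousAt (fun v : ℝ => Complex.exp (-(v : ℂ) * Φ y₀)) 0 := by fun_prop
    obtain ⟨ε, hε, h1⟩ := Metric.continuousAt_iff.1 hc (1 / 2) (by norm_num)
    refine ⟨⟨ε / 2, by positivity⟩, NNReal.coe_pos.1 (half_pos hε), fun v hv0 hv => ?_⟩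
    have hv' : v ≤ ε / 2 := hv
    have := h1 (x := v) (by rw [Real.dist_eq, sub_zero, abs_of_nonneg hv0]; linarith)
    rw [Complex.dist_eq] at this
    simpa using this.le
  have hδr : (0 : ℝ) < δ := hδ
  set J : ℝ → ℂ := fun y => ∫ v in (0 : ℝ)..δ, Complex.exp (-(v : ℂ) * Φ y) with hJ
  have hJc : Continuous J := by
    refine intervalIntegral.continuous_of_dominated_interval (bound := fun _ => 1) ?_ ?_
      (by simp) ?_
    · exact fun y => Continuous.aestronglyMeasurable (by fun_prop)
    · refine fun y => Eventually.of_forall fun v hv => ?_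
      rw [uIoc_of_le hδr.le] at hv
      exact h.norm_exp_le_one ⟨v, hv.1.le⟩ y
    · refine Eventually.of_forall fun v hv => ?_
      rw [uIoc_of_le hδr.le] at hv
      exact h.continuous_exp hX ⟨v, hv.1.le⟩
  have hJ0 : J y₀ ≠ 0 := by
    intro h0
    have e1 : ∫ v in (0 : ℝ)..δ, (Complex.exp (-(v : ℂ) * Φ y₀) - 1) = -(δ : ℝ) := by
      rw [intervalIntegral.integral_sub
        (Continuous.intervalIntegrable (by fun_prop) _ _) (by simp)]
      rw [show (∫ v in (0 : ℝ)..δ, Complex.exp (-(v : ℂ) * Φ y₀)) = 0 from h0]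
      simp
    have e2 := intervalIntegral.norm_integral_le_of_norm_le_const (a := 0) (b := (δ : ℝ))
      (C := 1 / 2) (f := fun v : ℝ => Complex.exp (-(v : ℂ) * Φ y₀) - 1) (by
        intro v hv
        rw [uIoc_of_le hδr.le] at hv
        exact hδ' v hv.1.le hv.2)
    rw [e1, norm_neg, Complex.norm_real, Real.norm_of_nonneg hδr.le, sub_zero,
      abs_of_pos hδr] at e2
    linarith
  have hid : ∀ y, J y * Φ y = 1 - Complex.exp (-((δ : ℝ) : ℂ) * Φ y) := by
    intro y
    have hd : ∀ v ∈ uIcc (0 : ℝ) δ, HasDerivAt (fun v : ℝ => -Complex.exp (-(v : ℂ) * Φ y))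
        (Complex.exp (-(v : ℂ) * Φ y) * Φ y) v := by
      intro v _
      have h1 : HasDerivAt (fun v : ℝ => -(v : ℂ) * Φ y) (-1 * Φ y) v :=
        (Complex.ofRealCLM.hasDerivAt (x := v)).neg.mul_const _
      exact h1.cexp.neg.congr_deriv (by ring)
    have := intervalIntegral.integral_eq_sub_of_hasDerivAt hd
      (Continuous.intervalIntegrable (by fun_prop) _ _)
    rw [hJ]
    simp only
    rw [← intervalIntegral.integral_mul_const, this]
    simp
    ring
  have hev : Φ =ᶠ[𝓝 y₀] fun y => (1 - Complex.exp (-((δ : ℝ) : ℂ) * Φ y)) / J y := by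
    filter_upwards [hJc.continuousAt.eventually_ne hJ0] with y hy
    rw [← hid, mul_div_cancel_left₀ _ hy]
  refine ContinuousAt.congr ?_ hev.symm
  exact (continuousAt_const.sub (h.continuous_exp hX δ).continuousAt).div hJc.continuousAt hJ0

theorem IsLevyProcess.integral_exp_increment (hX : IsLevyProcess X P)
    (h : HasCharExponent X P Φ) {u v : ℝ≥0} (huv : u ≤ v) (y : ℝ) :
    ∫ ω, Complex.exp (Complex.I * (y : ℂ) * ((X v ω - X u ω : ℝ) : ℂ)) ∂P =
      Complex.exp (-((v - u : ℝ) : ℂ) * Φ y) := by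
  obtain ⟨d, rfl⟩ := exists_add_of_le huv
  have h1 := (hX.stationary_increments u d).comp
    (u := fun x : ℝ => Complex.exp (Complex.I * (y : ℂ) * (x : ℂ))) (by fun_prop)
  have h2 := h1.integral_eq
  simp only [Function.comp_def] at h2
  rw [h2]
  have e : ((((u + d : ℝ≥0) : ℝ) - (u : ℝ) : ℝ) : ℂ) = ((d : ℝ) : ℂ) := by push_cast; ring
  rw [e, ← h d y]
  refine integral_congr_ae ?_
  filter_upwards [hX.start_zero] with ω hω
  rw [hω, sub_zero]

theorem ae_eq_zero_of_integral_exp_eq_one [IsProbabilityMeasure P] {D : Ω → ℝ} (hD : Measurable D)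
    (h : ∀ y : ℝ, ∫ ω, Complex.exp (Complex.I * (y : ℂ) * (D ω : ℂ)) ∂P = 1) :
    ∀ᵐ ω ∂P, D ω = 0 := by
  have : IsProbabilityMeasure (P.map D) := Measure.isProbabilityMeasure_map hD.aemeasurable
  have h1 : P.map D = Measure.dirac 0 := by
    refine Measure.ext_of_charFun ?_
    ext y
    rw [charFun_apply_real, charFun_apply_real, integral_map hD.aemeasurable
      (by fun_prop), integral_dirac]
    simp only [Complex.ofReal_zero, mul_zero, zero_mul, Complex.exp_zero]
    rw [← h y]
    congr 1
    ext ω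
    congr 1
    ring
  have h2 : ∀ᵐ x ∂(P.map D), x = 0 := by
    rw [h1]
    simp
  exact ae_of_ae_map hD.aemeasurable h2

/-- A Lévy process is almost surely continuous at each fixed time. -/
theorem IsLevyProcess.ae_continuousAt [IsProbabilityMeasure P] (hX : IsLevyProcess X P) (h : HasCharExponent X P Φ)
    (u : ℝ≥0) : ∀ᵐ ω ∂P, ContinuousAt (fun v => X v ω) u := by
  rcases eq_or_lt_of_le (zero_le : 0 ≤ u) with rfl | hu
  · filter_upwards [hX.cadlag] with ω hω
    have h1 := (hω 0).1
    have h2 : Ici (0 : ℝ≥0) = univ := by ext; simp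
    rwa [h2, continuousWithinAt_univ] at h1
  obtain ⟨v, -, hv, hvlim⟩ := exists_seq_strictMono_tendsto' hu
  have hv' : Tendsto v atTop (𝓝[<] u) :=
    tendsto_nhdsWithin_iff.2 ⟨hvlim, Eventually.of_forall fun n => (hv n).2⟩
  have hm : ∀ n, Measurable (fun ω => X u ω - X (v n) ω) := fun n =>
    (hX.measurable u).sub (hX.measurable _)
  -- `D` is the jump at time `u`. Its characteristic function is the limit of `exp (-(u - v n) Φ
  -- y)`, which is 1, so the jump vanishes almost surely.
  obtain ⟨D, hDm, hD⟩ := measurable_limit_of_tendsto_metrizable_ae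
    (f := fun n ω => X u ω - X (v n) ω) (μ := P) (L := atTop) (fun n => (hm n).aemeasurable) (by
      filter_upwards [hX.cadlag] with ω hω
      obtain ⟨l, hl⟩ := (hω u).2
      exact ⟨X u ω - l, tendsto_const_nhds.sub (hl.comp hv')⟩)
  have hD0 : ∀ᵐ ω ∂P, D ω = 0 := by
    refine ae_eq_zero_of_integral_exp_eq_one hDm fun y => ?_
    have t1 : Tendsto (fun n => ∫ ω, Complex.exp (Complex.I * (y : ℂ) *
        ((X u ω - X (v n) ω : ℝ) : ℂ)) ∂P) atTop
        (𝓝 (∫ ω, Complex.exp (Complex.I * (y : ℂ) * (D ω : ℂ)) ∂P)) := by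
      refine tendsto_integral_of_dominated_convergence (fun _ => 1) ?_ (integrable_const _) ?_ ?_
      · intro n
        have := hm n
        exact Measurable.aestronglyMeasurable (by fun_prop)
      · exact fun n => Eventually.of_forall fun ω => (norm_exp_I_mul y _).le
      · filter_upwards [hD] with ω hω
        have hc : Continuous fun x : ℝ => Complex.exp (Complex.I * (y : ℂ) * (x : ℂ)) := by
          fun_prop
        exact hc.continuousAt.tendsto.comp hω
    have t2 : Tendsto (fun n => Complex.exp (-(((u : ℝ) - (v n : ℝ) : ℝ) : ℂ) * Φ y)) atTop
        (𝓝 1) := by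
      have h1 : Tendsto (fun n => ((v n : ℝ≥0) : ℝ)) atTop (𝓝 (u : ℝ)) :=
        (NNReal.continuous_coe.tendsto u).comp hvlim
      have hc : Continuous fun x : ℝ => Complex.exp (-(((u : ℝ) - x : ℝ) : ℂ) * Φ y) := by
        fun_prop
      simpa [Function.comp_def] using (hc.tendsto (u : ℝ)).comp h1
    refine tendsto_nhds_unique t1 (t2.congr fun n => ?_)
    exact (hX.integral_exp_increment h (hv n).2.le y).symm
  filter_upwards [hX.cadlag, hD, hD0] with ω h1 h2 h3
  obtain ⟨l, hl⟩ := (h1 u).2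
  have hlu : l = X u ω := by
    have := tendsto_nhds_unique h2 (tendsto_const_nhds.sub (hl.comp hv'))
    rw [h3] at this
    linarith
  rw [hlu] at hl
  rw [ContinuousAt, ← nhdsLT_sup_nhdsGE]
  exact hl.sup (h1 u).1

end Exponent

/-! ### Càdlàg paths: local boundedness and joint measurability -/

section Cadlag

/-- Right-continuous with left limits. -/
def IsCadlagPath (p : ℝ≥0 → ℝ) : Prop :=
  ∀ u : ℝ≥0, ContinuousWithinAt p (Ici u) u ∧ ∃ l : ℝ, Tendsto p (𝓝[<] u) (𝓝 l)

/-- The one-sided limits bound the path near each time; compactness of `[0, T]` makes the bound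
uniform. -/
theorem IsCadlagPath.exists_bound {p : ℝ≥0 → ℝ} (hp : IsCadlagPath p) (T : ℝ≥0) :
    ∃ C, ∀ u ≤ T, |p u| ≤ C := by
  have key : ∃ C, ∀ u ∈ Icc 0 T, |p u| ≤ C := by
    refine isCompact_Icc.induction_on (p := fun S => ∃ C, ∀ u ∈ S, |p u| ≤ C)
      ⟨0, by simp⟩ (fun S S' h ⟨C, hC⟩ => ⟨C, fun u hu => hC u (h hu)⟩) ?_ ?_
    · rintro S S' ⟨C, hC⟩ ⟨C', hC'⟩
      refine ⟨max C C', fun u hu => ?_⟩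
      rcases hu with hu | hu
      · exact (hC u hu).trans (le_max_left _ _)
      · exact (hC' u hu).trans (le_max_right _ _)
    · intro u _
      obtain ⟨h1, l, h2⟩ := hp u
      have b1 : ∀ᶠ v in 𝓝[≥] u, |p v| ≤ |p u| + 1 :=
        (h1.tendsto.abs.eventually (gt_mem_nhds (lt_add_one _))).mono fun _ h => h.le
      have b2 : ∀ᶠ v in 𝓝[<] u, |p v| ≤ |l| + 1 :=
        (h2.abs.eventually (gt_mem_nhds (lt_add_one _))).mono fun _ h => h.le
      refine ⟨{v | |p v| ≤ max (|p u| + 1) (|l| + 1)}, mem_nhdsWithin_of_mem_nhds ?_, _,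
        fun v hv => hv⟩
      rw [← nhdsLT_sup_nhdsGE]
      exact mem_sup.2 ⟨b2.mono fun v hv => hv.trans (le_max_right _ _),
        b1.mono fun v hv => hv.trans (le_max_left _ _)⟩
  obtain ⟨C, hC⟩ := key
  exact ⟨C, fun u hu => hC u ⟨zero_le, hu⟩⟩

/-- The least grid point `k / (n + 1)` strictly above `u`. -/
noncomputable def nextGridPoint (n : ℕ) (u : ℝ≥0) : ℝ≥0 := (⌊(n + 1) * u⌋₊ + 1 : ℕ) / (n + 1)

theorem le_nextGridPoint (n : ℕ) (u : ℝ≥0) : u ≤ nextGridPoint n u := by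
  rw [nextGridPoint, le_div_iff₀ (by positivity), mul_comm]
  push_cast
  exact (Nat.lt_floor_add_one _).le

theorem tendsto_nextGridPoint (u : ℝ≥0) :
    Tendsto (fun n => nextGridPoint n u) atTop (𝓝[≥] u) := by
  refine tendsto_nhdsWithin_iff.2 ⟨?_, Eventually.of_forall fun n => le_nextGridPoint n u⟩
  have h1 : Tendsto (fun n : ℕ => u + 1 / ((n : ℝ≥0) + 1)) atTop (𝓝 u) := by
    simpa using tendsto_const_nhds.add (tendsto_one_div_add_atTop_nhds_zero_nat (𝕜 := ℝ≥0))
  refine tendsto_of_tendsto_of_tendsto_of_le_of_le tendsto_const_nhds h1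
    (fun n => le_nextGridPoint n u) fun n => ?_
  simp only [nextGridPoint]
  have hn : (n : ℝ≥0) + 1 ≠ 0 := by positivity
  rw [div_le_iff₀ (by positivity), add_mul u, div_mul_cancel₀ _ hn]
  push_cast
  gcongr
  rw [mul_comm u]
  exact Nat.floor_le zero_le

variable {Ω : Type*} [MeasurableSpace Ω]

/-- Rounding time up to a grid leaves countably many values of time, hence a jointly measurable map;
right continuity makes these maps converge to `Z`. -/
theorem measurable_uncurry_of_rightContinuous {Z : ℝ≥0 → Ω → ℝ} (hZ : ∀ u, Measurable (Z u))
    (hr : ∀ ω u, ContinuousWithinAt (fun v => Z v ω) (Ici u) u) :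
    Measurable fun q : ℝ≥0 × Ω => Z q.1 q.2 := by
  refine measurable_of_tendsto_metrizable (f := fun n (q : ℝ≥0 × Ω) => Z (nextGridPoint n q.1) q.2)
    ?_ ?_
  · intro n
    have h1 : Measurable fun q : ℕ × Ω => Z ((q.1 + 1 : ℕ) / (n + 1)) q.2 :=
      measurable_from_prod_countable_right (f := fun q : ℕ × Ω => Z ((q.1 + 1 : ℕ) / (n + 1)) q.2)
        fun k => hZ ((k + 1 : ℕ) / (n + 1))
    exact h1.comp (f := fun q : ℝ≥0 × Ω => (⌊((n : ℝ≥0) + 1) * q.1⌋₊, q.2)) (by fun_prop)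
  · rw [tendsto_pi_nhds]
    rintro ⟨u, ω⟩
    exact (hr ω u).tendsto.comp (tendsto_nextGridPoint u)

/-- Paths are set to zero off a measurable almost sure set of càdlàg paths. The Fubini arguments
need this joint measurability, while the process itself has only measurable marginals. -/
theorem exists_measurable_modification {P : Measure Ω} {Z : ℝ≥0 → Ω → ℝ}
    (hZ : ∀ u, Measurable (Z u)) (hc : ∀ᵐ ω ∂P, IsCadlagPath fun v => Z v ω) :
    ∃ Z' : ℝ≥0 → Ω → ℝ, (Measurable fun q : ℝ≥0 × Ω => Z' q.1 q.2) ∧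
      (∀ ω, IsCadlagPath fun v => Z' v ω) ∧ ∀ᵐ ω ∂P, ∀ u, Z u ω = Z' u ω := by
  obtain ⟨S, hS, hSm, hSc⟩ := hc.exists_measurable_mem
  have hcad : ∀ ω, IsCadlagPath fun v => S.indicator (Z v) ω := by
    intro ω
    by_cases hω : ω ∈ S
    · simpa only [indicator_of_mem hω] using hSc ω hω
    · simp only [indicator_of_notMem hω]
      exact fun u => ⟨continuousWithinAt_const, 0, tendsto_const_nhds⟩
  refine ⟨fun u => S.indicator (Z u), ?_, hcad, ?_⟩
  · exact measurable_uncurry_of_rightContinuous (fun u => (hZ u).indicator hSm)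
      fun ω u => (hcad ω u).1
  · filter_upwards [hS] with ω hω u
    rw [indicator_of_mem hω]

end Cadlag

/-! ### Weighted expectations: integrability, truncation and convergence of clocks -/

section WeightedExpectation

/-- No integrability is needed: the integral of a non-integrable function is 0 by convention, and
the exponential is then 1. -/
theorem norm_exp_neg_integral_le_one {α : Type*} [MeasurableSpace α] {ν : Measure α} {g : α → ℂ}
    (hg : ∀ w, 0 ≤ (g w).re) : ‖Complex.exp (-∫ w, g w ∂ν)‖ ≤ 1 := by
  rw [Complex.norm_exp, Real.exp_le_one_iff, Complex.neg_re, neg_nonpos]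
  by_cases hi : Integrable g ν
  · have := integral_re hi
    simp only [RCLike.re_eq_complex_re] at this
    rw [← this]
    exact integral_nonneg hg
  · rw [integral_undef hi]
    simp

theorem norm_exp_neg_additiveFunctional_le_one {Ω : Type*} {Z : ℝ≥0 → Ω → ℝ}
    {ψ : ℝ → ℂ} {μ : Measure I} {a : I → ℝ≥0} (hψ : ∀ y, 0 ≤ (ψ y).re) (x : ℝ) (ω : Ω) :
    ‖Complex.exp (-additiveFunctional ψ Z a μ x ω)‖ ≤ 1 :=
  norm_exp_neg_integral_le_one fun _ => hψ _

theorem tendsto_weightedExpectation_of_tendsto {Ω : Type*} [MeasurableSpace Ω]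
    {P : Measure Ω} [IsProbabilityMeasure P] {Z : ℝ≥0 → Ω → ℝ} {ψ : ℝ → ℂ} {μ : Measure I}
    {a : I → ℝ≥0} {f : ℝ → ℂ} {b : ℕ → I → ℝ≥0} {u : ℕ → ℝ → ℂ} {T : ℝ≥0}
    (hmem' : ∀ n, MemLp (fun p : ℝ × Ω => Complex.exp (-additiveFunctional ψ Z (b n) μ p.1 p.2) *
      u n (p.1 + Z T p.2)) 2 (volume.prod P))
    (hmem : MemLp (fun p : ℝ × Ω => Complex.exp (-additiveFunctional ψ Z a μ p.1 p.2) *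
      f (p.1 + Z T p.2)) 2 (volume.prod P))
    (hlim : Tendsto (fun n => eLpNorm (
      (fun p : ℝ × Ω => Complex.exp (-additiveFunctional ψ Z (b n) μ p.1 p.2) *
        u n (p.1 + Z T p.2)) -
      fun p : ℝ × Ω => Complex.exp (-additiveFunctional ψ Z a μ p.1 p.2) *
        f (p.1 + Z T p.2)) 2 (volume.prod P)) atTop (𝓝 0)) :
    Tendsto (fun n => eLpNorm (weightedExpectation P ψ Z (b n) μ T (u n) -
      weightedExpectation P ψ Z a μ T f) 2 volume) atTop (𝓝 0) := by
  have h1 := fun n => (hmem' n).ae_integrable_slice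
  have h2 := hmem.ae_integrable_slice
  have key := tendsto_eLpNorm_integral hmem' hmem h1 h2 hlim
  exact key

variable {Ω : Type*} [MeasurableSpace Ω] {P : Measure Ω}
  {Z : ℝ≥0 → Ω → ℝ} {ψ : ℝ → ℂ} {μ : Measure I} [IsFiniteMeasure μ] {a : I → ℝ≥0} {f : ℝ → ℂ}

theorem IsCadlagPath.exists_bound_comp {p : ℝ≥0 → ℝ} (hp : IsCadlagPath p) (hψ : Continuous ψ)
    (T : ℝ≥0) (x : ℝ) : ∃ C, ∀ u ≤ T, ‖ψ (x + p u)‖ ≤ C := by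
  obtain ⟨C, hC⟩ := hp.exists_bound T
  obtain ⟨K, hK⟩ := (isCompact_closedBall x C).exists_bound_of_continuousOn hψ.continuousOn
  refine ⟨K, fun u hu => hK _ ?_⟩
  rw [Metric.mem_closedBall, Real.dist_eq]
  simpa using hC u hu

theorem ae_integrableOn_exponent (hZ : ∀ u, Measurable (Z u))
    (hc : ∀ᵐ ω ∂P, IsCadlagPath fun v => Z v ω) (hψ : Continuous ψ) (ha : Measurable a)
    {T : ℝ≥0} (haT : ∀ w, a w ≤ T) :
    ∀ᵐ ω ∂P, ∀ x : ℝ, IntegrableOn (fun w => ψ (x + Z (a w) ω)) (Ioc (0 : I) 1) μ := by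
  obtain ⟨Z', hm, hc', he⟩ := exists_measurable_modification hZ hc
  filter_upwards [he] with ω hω x
  simp only [hω]
  obtain ⟨C, hC⟩ := (hc' ω).exists_bound_comp hψ T x
  refine Integrable.of_bound (C := C) ?_ (Eventually.of_forall fun w => hC _ (haT w))
  have : Measurable fun w => Z' (a w) ω := hm.comp (by fun_prop : Measurable fun w => (a w, ω))
  exact (hψ.measurable.comp (by fun_prop)).aestronglyMeasurable

theorem aestronglyMeasurable_exp_neg_additiveFunctional [SFinite P] (hZ : ∀ u, Measurable (Z u))
    (hc : ∀ᵐ ω ∂P, IsCadlagPath fun v => Z v ω) (hψ : Continuous ψ) (ha : Measurable a) :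
    AEStronglyMeasurable (fun p : ℝ × Ω => Complex.exp (-additiveFunctional ψ Z a μ p.1 p.2))
      (volume.prod P) := by
  obtain ⟨Z', hm, hc', he⟩ := exists_measurable_modification hZ hc
  have h1 : StronglyMeasurable fun p : ℝ × Ω => additiveFunctional ψ Z' a μ p.1 p.2 := by
    unfold additiveFunctional
    refine StronglyMeasurable.integral_prod_right (f := fun (p : ℝ × Ω) w => ψ (p.1 + Z' (a w) p.2))
      ?_
    have : Measurable fun q : (ℝ × Ω) × I => Z' (a q.2) q.1.2 :=
      hm.comp (by fun_prop : Measurable fun q : (ℝ × Ω) × I => (a q.2, q.1.2))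
    exact (hψ.measurable.comp (by fun_prop)).stronglyMeasurable
  refine ⟨fun p => Complex.exp (-additiveFunctional ψ Z' a μ p.1 p.2),
    Complex.continuous_exp.comp_stronglyMeasurable h1.neg, ?_⟩
  have h2 : ∀ᵐ p ∂((volume : Measure ℝ).prod P), ∀ u, Z u p.2 = Z' u p.2 :=
    Measure.quasiMeasurePreserving_snd.ae he
  filter_upwards [h2] with p hp
  simp only [additiveFunctional, hp]

variable [IsProbabilityMeasure P]

theorem memLp_weight_mul (hZ : ∀ u, Measurable (Z u))
    (hc : ∀ᵐ ω ∂P, IsCadlagPath fun v => Z v ω) (hψ : Continuous ψ) (hψ0 : ∀ y, 0 ≤ (ψ y).re)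
    (ha : Measurable a) (T : ℝ≥0) (hf : MemLp f 2 volume) :
    MemLp (fun p : ℝ × Ω => Complex.exp (-additiveFunctional ψ Z a μ p.1 p.2) *
      f (p.1 + Z T p.2)) 2 (volume.prod P) :=
  memLp_mul_comp_add hf (hZ T) (aestronglyMeasurable_exp_neg_additiveFunctional hZ hc hψ ha)
    (Eventually.of_forall fun _ => norm_exp_neg_additiveFunctional_le_one hψ0 _ _)

theorem memLp_weightedExpectation (hZ : ∀ u, Measurable (Z u))
    (hc : ∀ᵐ ω ∂P, IsCadlagPath fun v => Z v ω) (hψ : Continuous ψ) (hψ0 : ∀ y, 0 ≤ (ψ y).re)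
    (ha : Measurable a) (T : ℝ≥0) (hf : MemLp f 2 volume) :
    MemLp (weightedExpectation P ψ Z a μ T f) 2 volume :=
  memLp_integral (memLp_weight_mul hZ hc hψ hψ0 ha T hf)

theorem memLp_truncate (hf : MemLp f 2 volume) (n : ℕ) : MemLp (truncate f n) 2 volume := by
  refine hf.of_le ?_ (Eventually.of_forall fun x => norm_indicator_le_norm_self _ _)
  exact hf.1.indicator₀ (nullMeasurableSet_le hf.1.norm.aemeasurable aemeasurable_const)

/-- Truncation multiplies the integrand by an indicator at `x + Z_T`, bounded by 1 and equal to 1 at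
each point for large `n`. -/
theorem tendsto_weightedExpectation_truncate (hZ : ∀ u, Measurable (Z u))
    (hc : ∀ᵐ ω ∂P, IsCadlagPath fun v => Z v ω) (hψ : Continuous ψ) (hψ0 : ∀ y, 0 ≤ (ψ y).re)
    (ha : Measurable a) (T : ℝ≥0) (hf : MemLp f 2 volume) :
    Tendsto (fun n => eLpNorm (weightedExpectation P ψ Z a μ T (truncate f n) -
      weightedExpectation P ψ Z a μ T f) 2 volume) atTop (𝓝 0) := by
  have hmem := memLp_weight_mul (μ := μ) hZ hc hψ hψ0 ha T hf
  refine tendsto_weightedExpectation_of_tendsto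
    (fun n => memLp_weight_mul hZ hc hψ hψ0 ha T (memLp_truncate hf n)) hmem ?_
  have hind : ∀ n : ℕ, AEStronglyMeasurable ({x | ‖f x‖ ≤ n}.indicator (fun _ => (1 : ℂ)))
      volume := fun n => (aestronglyMeasurable_const).indicator₀
        (nullMeasurableSet_le hf.1.norm.aemeasurable aemeasurable_const)
  have hlim : ∀ x : ℝ, Tendsto (fun n : ℕ => {x | ‖f x‖ ≤ n}.indicator (fun _ => (1 : ℂ)) x)
      atTop (𝓝 1) := by
    intro x
    obtain ⟨N, hN⟩ := exists_nat_ge ‖f x‖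
    refine tendsto_const_nhds.congr' ?_
    filter_upwards [eventually_ge_atTop N] with n hn
    rw [indicator_of_mem]
    exact hN.trans (by exact_mod_cast hn)
  have key := tendsto_eLpNorm_mul_of_bounded (μ := (volume : Measure ℝ).prod P)
    (e := fun n p => {x | ‖f x‖ ≤ n}.indicator (fun _ => (1 : ℂ)) (p.1 + Z T p.2))
    (e' := fun _ => 1)
    (fun n => (hind n).comp_measurePreserving (measurePreserving_add_randomVariable (hZ T)))
    (fun n => Eventually.of_forall fun p =>
      (norm_indicator_le_norm_self (fun _ => (1 : ℂ)) _).trans norm_one.le)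
    (Eventually.of_forall fun p => hlim _) hmem
  refine key.congr fun n => ?_
  congr 1
  ext p
  simp only [Pi.sub_apply, one_mul, truncate, indicator]
  split_ifs <;> simp

theorem wellDefinedExpectation (hZ : ∀ u, Measurable (Z u))
    (hc : ∀ᵐ ω ∂P, IsCadlagPath fun v => Z v ω) (hψ : Continuous ψ) (hψ0 : ∀ y, 0 ≤ (ψ y).re)
    (ha : Measurable a) {T' : ℝ≥0} (haT : ∀ w, a w ≤ T') (T : ℝ≥0) (hf : MemLp f 2 volume) :
    WellDefinedExpectation P ψ Z a μ T f where
  integrable_exponent := ae_integrableOn_exponent hZ hc hψ ha haT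
  integrable := (memLp_weight_mul hZ hc hψ hψ0 ha T hf).ae_integrable_slice
  memLp_truncate n := memLp_weightedExpectation hZ hc hψ hψ0 ha T (memLp_truncate hf n)
  tendsto_truncate := tendsto_weightedExpectation_truncate hZ hc hψ hψ0 ha T hf

/-- The exceptional null set of paths may depend on `w`; Fubini exchanges the quantifiers, at the
cost of a null set of `w` for each path. -/
theorem ae_ae_tendsto_comp_clock (hZ : ∀ u, Measurable (Z u))
    (hc : ∀ᵐ ω ∂P, IsCadlagPath fun v => Z v ω) {b : ℕ → I → ℝ≥0} (hb : ∀ n, Measurable (b n))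
    (ha : Measurable a) {S : Set I} (hS : MeasurableSet S)
    (h : ∀ w ∈ S, ∀ᵐ ω ∂P, Tendsto (fun n => Z (b n w) ω) atTop (𝓝 (Z (a w) ω))) :
    ∀ᵐ ω ∂P, ∀ᵐ w ∂(μ.restrict S), Tendsto (fun n => Z (b n w) ω) atTop (𝓝 (Z (a w) ω)) := by
  obtain ⟨Z', hm, hc', he⟩ := exists_measurable_modification hZ hc
  have hms : MeasurableSet {q : I × Ω |
      Tendsto (fun n => Z' (b n q.1) q.2) atTop (𝓝 (Z' (a q.1) q.2))} := by
    refine measurableSet_tendsto_fun (fun n => ?_) ?_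
    · exact hm.comp (by fun_prop : Measurable fun q : I × Ω => (b n q.1, q.2))
    · exact hm.comp (by fun_prop : Measurable fun q : I × Ω => (a q.1, q.2))
  have h1 : ∀ᵐ w ∂(μ.restrict S), ∀ᵐ ω ∂P,
      Tendsto (fun n => Z' (b n w) ω) atTop (𝓝 (Z' (a w) ω)) := by
    filter_upwards [ae_restrict_mem hS] with w hw
    filter_upwards [h w hw, he] with ω h2 h3
    simpa only [h3] using h2
  have h2 := (Measure.ae_ae_comm hms).1 h1
  filter_upwards [h2, he] with ω h3 h4
  simpa only [h4] using h3

/-- Weighted expectations converge in `L²` when the clocks converge along the paths. -/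
theorem tendsto_weightedExpectation (hZ : ∀ u, Measurable (Z u))
    (hc : ∀ᵐ ω ∂P, IsCadlagPath fun v => Z v ω) (hψ : Continuous ψ) (hψ0 : ∀ y, 0 ≤ (ψ y).re)
    {b : ℕ → I → ℝ≥0} (hb : ∀ n, Measurable (b n)) (ha : Measurable a)
    {T' : ℝ≥0} (hbT : ∀ n w, b n w ≤ T')
    (h : ∀ w ∈ Ioc (0 : I) 1, ∀ᵐ ω ∂P, Tendsto (fun n => Z (b n w) ω) atTop (𝓝 (Z (a w) ω)))
    (T : ℝ≥0) (hf : MemLp f 2 volume) :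
    Tendsto (fun n => eLpNorm (weightedExpectation P ψ Z (b n) μ T f -
      weightedExpectation P ψ Z a μ T f) 2 volume) atTop (𝓝 0) := by
  refine tendsto_weightedExpectation_of_tendsto
    (fun n => memLp_weight_mul hZ hc hψ hψ0 (hb n) T hf)
    (memLp_weight_mul hZ hc hψ hψ0 ha T hf) ?_
  refine tendsto_eLpNorm_mul_of_bounded
    (fun n => aestronglyMeasurable_exp_neg_additiveFunctional hZ hc hψ (hb n))
    (fun n => Eventually.of_forall fun p => norm_exp_neg_additiveFunctional_le_one hψ0 _ _) ?_
    (hf.comp_measurePreserving (measurePreserving_add_randomVariable (hZ T)))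
  have h1 := ae_ae_tendsto_comp_clock (μ := μ) hZ hc hb ha measurableSet_Ioc h
  have h2 : ∀ᵐ ω ∂P, ∀ n, ∀ x : ℝ,
      IntegrableOn (fun w => ψ (x + Z (b n w) ω)) (Ioc (0 : I) 1) μ :=
    ae_all_iff.2 fun n => ae_integrableOn_exponent hZ hc hψ (hb n) (hbT n)
  have h3 : ∀ᵐ p ∂((volume : Measure ℝ).prod P), Tendsto
      (fun n => additiveFunctional ψ Z (b n) μ p.1 p.2) atTop
      (𝓝 (additiveFunctional ψ Z a μ p.1 p.2)) := by
    filter_upwards [Measure.quasiMeasurePreserving_snd.ae (h1.and (h2.and hc))] with p hp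
    obtain ⟨g1, g2, g3⟩ := hp
    obtain ⟨C, hC⟩ := g3.exists_bound_comp hψ T' p.1
    refine tendsto_integral_of_dominated_convergence (fun _ => C) (fun n => (g2 n p.1).1)
      (integrable_const _) (fun n => Eventually.of_forall fun w => hC _ (hbT n w)) ?_
    filter_upwards [g1] with w hw
    exact (hψ.tendsto _).comp (tendsto_const_nhds.add hw)
  filter_upwards [h3] with p hp
  exact (Complex.continuous_exp.tendsto _).comp hp.neg

end WeightedExpectation

/-! ### Uniform grids on the unit interval -/

section Grid

/-- The point `k / N` of the unit interval (`1` if `k > N`). -/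
noncomputable def gridPt (N k : ℕ) : I := projIcc 0 1 zero_le_one ((k : ℝ) / N)

theorem monotone_gridPt (N : ℕ) : Monotone (gridPt N) := fun _ _ h =>
  monotone_projIcc _ (by gcongr)

theorem gridPt_zero (N : ℕ) : gridPt N 0 = 0 := by
  simp [gridPt]

theorem gridPt_self {N : ℕ} (hN : N ≠ 0) : gridPt N N = 1 := by
  simp [gridPt, hN]

theorem coe_gridPt {N k : ℕ} (hk : k ≤ N) : (gridPt N k : ℝ) = k / N := by
  rw [gridPt, projIcc_of_mem zero_le_one]
  exact ⟨by positivity, div_le_one_of_le₀ (by exact_mod_cast hk) (by positivity)⟩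

theorem ceil_mul_le (N : ℕ) (w : I) : ⌈(N : ℝ) * w⌉₊ ≤ N :=
  Nat.ceil_le.2 (mul_le_of_le_one_right (by positivity) w.2.2)

theorem ceil_mul_eq_of_mem_Ioc {N k : ℕ} (hk : k < N) {w : I}
    (hw : w ∈ Ioc (gridPt N k) (gridPt N (k + 1))) : ⌈(N : ℝ) * w⌉₊ = k + 1 := by
  have hN : (0 : ℝ) < N := by exact_mod_cast (Nat.zero_le k).trans_lt hk
  have h1 : (gridPt N k : ℝ) < w := hw.1
  have h2 : (w : ℝ) ≤ gridPt N (k + 1) := hw.2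
  rw [coe_gridPt hk.le, div_lt_iff₀ hN] at h1
  rw [coe_gridPt hk, le_div_iff₀ hN] at h2
  rw [Nat.ceil_eq_iff (by simp)]
  constructor
  · simpa [mul_comm] using h1
  · rwa [mul_comm]

theorem tendsto_gridPt_ceil (w : I) :
    Tendsto (fun n : ℕ => gridPt (n + 1) ⌈((n + 1 : ℕ) : ℝ) * w⌉₊) atTop (𝓝[≥] w) := by
  have key : ∀ n : ℕ, (w : ℝ) ≤ gridPt (n + 1) ⌈((n + 1 : ℕ) : ℝ) * w⌉₊ ∧
      (gridPt (n + 1) ⌈((n + 1 : ℕ) : ℝ) * w⌉₊ : ℝ) ≤ w + 1 / ((n : ℝ) + 1) := by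
    intro n
    have hpos : (0 : ℝ) < ((n + 1 : ℕ) : ℝ) := by positivity
    rw [coe_gridPt (ceil_mul_le _ w)]
    refine ⟨?_, ?_⟩
    · rw [le_div_iff₀ hpos, mul_comm]
      exact Nat.le_ceil _
    · rw [div_le_iff₀ hpos]
      have h1 := Nat.ceil_lt_add_one (mul_nonneg hpos.le w.2.1)
      have h2 : ((w : ℝ) + 1 / ((n : ℝ) + 1)) * ((n + 1 : ℕ) : ℝ) = ((n + 1 : ℕ) : ℝ) * w + 1 := by
        push_cast
        field_simp
      rw [h2]
      exact h1.le
  refine tendsto_nhdsWithin_iff.2 ⟨tendsto_subtype_rng.2 ?_, Eventually.of_forall fun n =>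
    Subtype.coe_le_coe.1 (key n).1⟩
  refine tendsto_of_tendsto_of_tendsto_of_le_of_le tendsto_const_nhds ?_
    (fun n => (key n).1) (fun n => (key n).2)
  simpa using (tendsto_one_div_add_atTop_nhds_zero_nat (𝕜 := ℝ)).const_add (w : ℝ)

/-- Since `⌈r⌉ - 1 < r`, the left end of the cell containing `w` is strictly below `w`, even when
`w` is a grid point. The strictness is what yields the left limit of `s`. -/
theorem tendsto_gridPt_ceil_sub_one {w : I} (hw : 0 < w) :
    Tendsto (fun n : ℕ => gridPt (n + 1) (⌈((n + 1 : ℕ) : ℝ) * w⌉₊ - 1)) atTop (𝓝[<] w) := by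
  have hw' : (0 : ℝ) < w := hw
  have key : ∀ n : ℕ, (w : ℝ) - 1 / ((n : ℝ) + 1) ≤
      gridPt (n + 1) (⌈((n + 1 : ℕ) : ℝ) * w⌉₊ - 1) ∧
      (gridPt (n + 1) (⌈((n + 1 : ℕ) : ℝ) * w⌉₊ - 1) : ℝ) < w := by
    intro n
    have hpos : (0 : ℝ) < ((n + 1 : ℕ) : ℝ) := by positivity
    have hc : 0 < ⌈((n + 1 : ℕ) : ℝ) * w⌉₊ := Nat.ceil_pos.2 (mul_pos hpos hw')
    rw [coe_gridPt ((Nat.sub_le _ _).trans (ceil_mul_le _ w)), Nat.cast_sub hc]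
    refine ⟨?_, ?_⟩
    · rw [le_div_iff₀ hpos]
      have h1 := Nat.le_ceil (((n + 1 : ℕ) : ℝ) * w)
      have h2 : ((w : ℝ) - 1 / ((n : ℝ) + 1)) * ((n + 1 : ℕ) : ℝ) = ((n + 1 : ℕ) : ℝ) * w - 1 := by
        push_cast
        field_simp
      rw [h2]
      simpa using h1
    · rw [div_lt_iff₀ hpos]
      have h1 := Nat.ceil_lt_add_one (mul_nonneg hpos.le w.2.1)
      push_cast at h1 ⊢
      linarith
  refine tendsto_nhdsWithin_iff.2 ⟨tendsto_subtype_rng.2 ?_, Eventually.of_forall fun n =>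
    Subtype.coe_lt_coe.1 (key n).2⟩
  refine tendsto_of_tendsto_of_tendsto_of_le_of_le ?_ tendsto_const_nhds
    (fun n => (key n).1) (fun n => (key n).2.le)
  simpa using (tendsto_one_div_add_atTop_nhds_zero_nat (𝕜 := ℝ)).const_sub (w : ℝ)

theorem measurable_comp_ceil_mul (N : ℕ) (c : ℕ → ℝ≥0) :
    Measurable fun w : I => c ⌈(N : ℝ) * w⌉₊ :=
  (measurable_from_nat (f := c)).comp (Nat.measurable_ceil.comp (by fun_prop))

/-- The Stieltjes integral over `(0,1]` of a function that is constant between grid points. -/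
theorem setIntegral_comp_ceil_mul (c : I → ℝ≥0) (hmono : Monotone c)
    (hright : ∀ w, ContinuousWithinAt c (Ici w) w) {N : ℕ} (hN : N ≠ 0) (v : ℕ → ℂ) :
    ∫ w in Ioc (0 : I) 1, v ⌈(N : ℝ) * w⌉₊ ∂(clockMeasure c hmono hright) =
      ∑ k ∈ Finset.range N, ((c (gridPt N (k + 1)) - c (gridPt N k) : ℝ) : ℂ) * v (k + 1) := by
  have hU : Ioc (0 : I) 1 = ⋃ k ∈ Finset.range N, Ioc (gridPt N k) (gridPt N (k + 1)) := by
    have := (monotone_gridPt N).biUnion_Ico_Ioc_map_succ 0 N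
    rw [gridPt_zero, gridPt_self hN] at this
    rw [← this]
    simp
  have hfin : ∀ a b : I, clockMeasure c hmono hright (Ioc a b) ≠ ∞ := by
    intro a b
    rw [clockMeasure, StieltjesFunction.measure_Ioc]
    exact ENNReal.ofReal_ne_top
  have hcongr : ∀ k ∈ Finset.range N, EqOn (fun w : I => v ⌈(N : ℝ) * w⌉₊) (fun _ => v (k + 1))
      (Ioc (gridPt N k) (gridPt N (k + 1))) := fun k hk w hw => by
    simp only [ceil_mul_eq_of_mem_Ioc (Finset.mem_range.1 hk) hw]
  have hdisj : Pairwise (Function.onFun Disjoint fun k => Ioc (gridPt N k) (gridPt N (k + 1))) :=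
    (monotone_gridPt N).pairwise_disjoint_on_Ioc_succ
  rw [hU, integral_biUnion_finset _ (fun _ _ => measurableSet_Ioc)
    (hdisj.set_pairwise _)]
  · refine Finset.sum_congr rfl fun k hk => ?_
    rw [setIntegral_congr_fun measurableSet_Ioc (hcongr k hk), setIntegral_const,
      Measure.real, clockMeasure, StieltjesFunction.measure_Ioc, ENNReal.toReal_ofReal,
      Complex.real_smul]
    · rfl
    · exact sub_nonneg.2 (NNReal.coe_le_coe.2 (hmono (monotone_gridPt N k.le_succ)))
  · intro k hk
    rw [integrableOn_congr_fun (hcongr k hk) measurableSet_Ioc]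
    exact integrableOn_const (hfin _ _)

end Grid

/-! ### The duality for finitely many time steps -/

section Discrete

variable {Ω : Type*} [MeasurableSpace Ω] {P : Measure Ω}
  {Ω' : Type*} [MeasurableSpace Ω'] {Q : Measure Ω'}
  {X : ℝ≥0 → Ω → ℝ} {Y : ℝ≥0 → Ω' → ℝ} {Φ Ψ : ℝ → ℂ}

/-- The joint characteristic function of the increments of a Lévy process. -/
theorem IsLevyProcess.integral_exp_sum_increments (hX : IsLevyProcess X P)
    (h : HasCharExponent X P Φ) {S : ℕ → ℝ≥0} (hS : Monotone S) (N : ℕ) (a : ℕ → ℝ) :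
    ∫ ω, Complex.exp (((∑ k ∈ Finset.range N, a k * (X (S (k + 1)) ω - X (S k) ω) : ℝ) : ℂ) *
      Complex.I) ∂P =
    Complex.exp (-∑ k ∈ Finset.range N, ((S (k + 1) - S k : ℝ) : ℂ) * Φ (a k)) := by
  have hind : iIndepFun (fun (i : Fin N) ω => X (S (i + 1)) ω - X (S i) ω) P :=
    (hX.indep_increments.nat hS).precomp Fin.val_injective
  have h1 := hind.integral_fun_prod_comp (𝕜 := ℂ)
    (f := fun (i : Fin N) (x : ℝ) => Complex.exp (Complex.I * (a i : ℂ) * (x : ℂ)))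
    (fun i => ((hX.measurable _).sub (hX.measurable _)).aemeasurable)
    (fun i => Continuous.aestronglyMeasurable (by fun_prop))
  simp only [hX.integral_exp_increment h (hS (Nat.le_succ _))] at h1
  rw [Finset.sum_range, ← Finset.sum_neg_distrib, Complex.exp_sum]
  convert h1 using 1
  · congr 1
    ext ω
    rw [Finset.sum_range, ← Complex.exp_sum]
    congr 1
    push_cast
    rw [Finset.sum_mul]
    exact Finset.sum_congr rfl fun i _ => by ring
  · exact Finset.prod_congr rfl fun i _ => by rw [neg_mul]

/-- Summation by parts. The left side is the phase obtained by transforming a translated, then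
modulated, function; the right side is the phase that the average over `X` can evaluate. -/
theorem sum_mul_sub_add_eq (x y : ℕ → ℝ) (hx : x 0 = 0) (z : ℝ) (N : ℕ) :
    ∑ k ∈ Finset.range N, x k * (y (k + 1) - y k) + x N * (z - y N) =
      ∑ k ∈ Finset.range N, (z - y (k + 1)) * (x (k + 1) - x k) := by
  induction N with
  | zero => simp [hx]
  | succ N ih =>
    rw [Finset.sum_range_succ, Finset.sum_range_succ, ← ih]
    ring

/-- The duality between the two expectations for finitely many time steps. -/
theorem isFourierPair_discrete [IsProbabilityMeasure P] [IsProbabilityMeasure Q]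
    (hX : IsLevyProcess X P) (hY : IsLevyProcess Y Q)
    (hΦ : HasCharExponent X P Φ) (hΨ : HasCharExponent Y Q Ψ) {S T : ℕ → ℝ≥0}
    (hS : Monotone S) (hT : Monotone T) (hS0 : S 0 = 0) (hT0 : T 0 = 0) (N : ℕ)
    {f g : ℝ → ℂ} (hfg : IsFourierPair f g) :
    IsFourierPair
      (fun x => ∫ ω, Complex.exp (-∑ k ∈ Finset.range N,
        ((T (k + 1) - T k : ℝ) : ℂ) * Ψ (x + X (S k) ω)) * f (x + X (S N) ω) ∂P)
      (fun z => ∫ ω, Complex.exp (-∑ k ∈ Finset.range N,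
        ((S (k + 1) - S k : ℝ) : ℂ) * Φ (z + -Y (T (k + 1)) ω)) * g (z + -Y (T N) ω) ∂Q) := by
  have hXm := hX.measurable
  have hYm := hY.measurable
  -- `K` and `L` are the two integrands before averaging: the phase of `K` is linear in the
  -- increments of `Y`, that of `L` in the increments of `X`.
  set K : ℝ × (Ω × Ω') → ℂ := fun p => Complex.exp (((∑ k ∈ Finset.range N,
    (p.1 + X (S k) p.2.1) * (Y (T (k + 1)) p.2.2 - Y (T k) p.2.2) : ℝ) : ℂ) * Complex.I) *
      f (p.1 + X (S N) p.2.1) with hK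
  set L : ℝ × (Ω × Ω') → ℂ := fun p => Complex.exp (((∑ k ∈ Finset.range N,
    (p.1 + -Y (T (k + 1)) p.2.2) * (X (S (k + 1)) p.2.1 - X (S k) p.2.1) : ℝ) : ℂ) * Complex.I) *
      g (p.1 + -Y (T N) p.2.2) with hL
  have hKm : MemLp K 2 (volume.prod (P.prod Q)) := by
    refine memLp_mul_comp_add hfg.memLp_left (P := P.prod Q)
      (Z := fun q : Ω × Ω' => X (S N) q.1) (by fun_prop)
      (Measurable.aestronglyMeasurable (by fun_prop)) (Eventually.of_forall fun p => ?_)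
    rw [Complex.norm_exp_ofReal_mul_I]
  have hLm : MemLp L 2 (volume.prod (P.prod Q)) := by
    refine memLp_mul_comp_add hfg.memLp_right (P := P.prod Q)
      (Z := fun q : Ω × Ω' => -Y (T N) q.2) (by fun_prop)
      (Measurable.aestronglyMeasurable (by fun_prop)) (Eventually.of_forall fun p => ?_)
    rw [Complex.norm_exp_ofReal_mul_I]
  have hKL : ∀ᵐ q ∂(P.prod Q), IsFourierPair (fun x => K (x, q)) (fun z => L (z, q)) := by
    filter_upwards [Measure.quasiMeasurePreserving_fst.ae hX.start_zero,
      Measure.quasiMeasurePreserving_snd.ae hY.start_zero] with q hq1 hq2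
    -- Since `Y` starts at 0, the part of the phase of `K` depending on `x` telescopes to `x * Y (T
    -- N)`. Thus `K` is a constant phase times one modulation of one translate of `f`.
    have h1 := (((hfg.comp_add_right (X (S N) q.1)).exp_mul (Y (T N) q.2)).const_mul
      (Complex.exp (((∑ k ∈ Finset.range N,
        X (S k) q.1 * (Y (T (k + 1)) q.2 - Y (T k) q.2) : ℝ) : ℂ) * Complex.I)))
    refine h1.congr (Eventually.of_forall fun x => ?_) (Eventually.of_forall fun z => ?_)
    · simp only [hK]
      rw [← mul_assoc, ← Complex.exp_add, ← add_mul, ← Complex.ofReal_add]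
      congr 4
      simp only [add_mul, Finset.sum_add_distrib]
      rw [← Finset.mul_sum, Finset.sum_range_sub (fun k => Y (T k) q.2), hT0, hq2]
      ring
    · simp only [hL]
      rw [← mul_assoc, ← Complex.exp_add, ← add_mul, ← Complex.ofReal_add, ← sub_eq_add_neg]
      congr 4
      simp only [← sub_eq_add_neg]
      exact sum_mul_sub_add_eq (fun k => X (S k) q.1) (fun k => Y (T k) q.2)
        (by rw [hS0, hq1]) z N
  -- Fubini is used in opposite orders: the inner integral is over `Y` for `K` and over `X` for `L`.
  refine (IsFourierPair.integral hKm hLm hKL).congr ?_ ?_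
  · filter_upwards [hKm.ae_integrable_slice] with x hx
    rw [integral_prod _ hx]
    congr 1
    ext ω
    simp only [hK]
    rw [integral_mul_const, hY.integral_exp_sum_increments hΨ hT N fun k => x + X (S k) ω]
  · filter_upwards [hLm.ae_integrable_slice] with z hz
    rw [integral_prod_symm _ hz]
    congr 1
    ext ω
    simp only [hL]
    rw [integral_mul_const,
      hX.integral_exp_sum_increments hΦ hS N fun k => z + -Y (T (k + 1)) ω]

end Discrete

/-! ### Passage to general clocks -/

theorem isFiniteMeasure_clockMeasure (c : I → ℝ≥0) (hmono : Monotone c)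
    (hright : ∀ w, ContinuousWithinAt c (Ici w) w) :
    IsFiniteMeasure (clockMeasure c hmono hright) := by
  unfold clockMeasure
  infer_instance

theorem proposition3p1
    {Ω : Type*} [MeasurableSpace Ω] (P : Measure Ω) [IsProbabilityMeasure P]
    {Ω' : Type*} [MeasurableSpace Ω'] (Q : Measure Ω') [IsProbabilityMeasure Q]
    (X : ℝ≥0 → Ω → ℝ) (Y : ℝ≥0 → Ω' → ℝ)
    (hX : IsLevyProcess X P) (hY : IsLevyProcess Y Q)
    (Φ Ψ : ℝ → ℂ) (hΦ : HasCharExponent X P Φ) (hΨ : HasCharExponent Y Q Ψ)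
    (s t : I → ℝ≥0)
    (hs : Monotone s) (hs_right : ∀ w, ContinuousWithinAt s (Ici w) w) (hs_zero : s 0 = 0)
    (ht : Monotone t) (ht_right : ∀ w, ContinuousWithinAt t (Ici w) w) (ht_zero : t 0 = 0)
    (f : ℝ → ℂ) (hf : MemLp f 2 volume) (F G : ℝ → ℂ)
    (hF : F = weightedExpectation P Ψ X (Function.leftLim s) (clockMeasure t ht ht_right) (s 1) f)
    (hG : G = weightedExpectation Q Φ (-Y) t (clockMeasure s hs hs_right) (t 1)
      (fourierL2 (hf.toLp f))) :
    WellDefinedExpectation P Ψ X (Function.leftLim s) (clockMeasure t ht ht_right) (s 1) f ∧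
    WellDefinedExpectation Q Φ (-Y) t (clockMeasure s hs hs_right) (t 1)
      (fourierL2 (hf.toLp f)) ∧
    ∃ hF_mem : MemLp F 2 volume, MemLp G 2 volume ∧ G =ᵐ[volume] fourierL2 (hF_mem.toLp F) := by
  have := isFiniteMeasure_clockMeasure s hs hs_right
  have := isFiniteMeasure_clockMeasure t ht ht_right
  have hΦc := hΦ.continuous hX.measurable
  have hΨc := hΨ.continuous hY.measurable
  have hXc : ∀ᵐ ω ∂P, IsCadlagPath fun v => X v ω := hX.cadlag
  have hZm : ∀ u, Measurable ((-Y) u) := fun u => (hY.measurable u).neg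
  have hZc : ∀ᵐ ω ∂Q, IsCadlagPath fun v => (-Y) v ω := by
    filter_upwards [hY.cadlag] with ω hω u
    obtain ⟨h1, l, h2⟩ := hω u
    exact ⟨h1.neg, -l, h2.neg⟩
  have hsm : Measurable (Function.leftLim s) := hs.leftLim.measurable
  have htm : Measurable t := ht.measurable
  have hs1 : ∀ w, Function.leftLim s w ≤ s 1 := fun w => hs.leftLim_le w.2.2
  have ht1 : ∀ w, t w ≤ t 1 := fun w => ht w.2.2
  have hg := memLp_fourierL2 (hf.toLp f)
  refine ⟨wellDefinedExpectation hX.measurable hXc hΨc hΨ.re_nonneg hsm hs1 _ hf,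
    wellDefinedExpectation hZm hZc hΦc hΦ.re_nonneg htm ht1 _ hg, ?_⟩
  -- On the grid cell containing `w`, `ρ` samples `s` at the left end and `κ` samples `t` at the
  -- right end, matching the indices `k` and `k + 1` of the discrete duality.
  let ρ : ℕ → I → ℝ≥0 := fun n w => s (gridPt (n + 1) (⌈((n + 1 : ℕ) : ℝ) * w⌉₊ - 1))
  let κ : ℕ → I → ℝ≥0 := fun n w => t (gridPt (n + 1) ⌈((n + 1 : ℕ) : ℝ) * w⌉₊)
  have hρ : ∀ n, Measurable (ρ n) := fun n =>
    measurable_comp_ceil_mul (n + 1) fun k => s (gridPt (n + 1) (k - 1))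
  have hκ : ∀ n, Measurable (κ n) := fun n =>
    measurable_comp_ceil_mul (n + 1) fun k => t (gridPt (n + 1) k)
  have hF_lim := tendsto_weightedExpectation (μ := clockMeasure t ht ht_right) hX.measurable hXc
    hΨc hΨ.re_nonneg hρ hsm (T' := s 1) (fun n w => hs (unitInterval.le_one _)) (by
      intro w hw
      -- The sampled times approach `s(w-)` from below, where a càdlàg path alone could tend to its
      -- own left limit; continuity at the fixed time `s(w-)` rules this out almost surely.
      filter_upwards [hX.ae_continuousAt hΦ (Function.leftLim s w)] with ω hω
      exact hω.tendsto.comp ((hs.tendsto_leftLim w).comp (tendsto_gridPt_ceil_sub_one hw.1)))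
    (s 1) hf
  have hG_lim := tendsto_weightedExpectation (μ := clockMeasure s hs hs_right) hZm hZc
    hΦc hΦ.re_nonneg hκ htm (T' := t 1) (fun n w => ht (unitInterval.le_one _)) (by
      intro w hw
      filter_upwards [hY.ae_continuousAt hΨ (t w)] with ω hω
      exact (hω.tendsto.comp ((ht_right w).tendsto.comp (tendsto_gridPt_ceil w))).neg)
    (t 1) hg
  have hpair : ∀ n, IsFourierPair
      (weightedExpectation P Ψ X (ρ n) (clockMeasure t ht ht_right) (s 1) f)
      (weightedExpectation Q Φ (-Y) (κ n) (clockMeasure s hs hs_right) (t 1)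
        (fourierL2 (hf.toLp f))) := by
    intro n
    have h1 := isFourierPair_discrete hX hY hΦ hΨ
      (hs.comp (monotone_gridPt (n + 1))) (ht.comp (monotone_gridPt (n + 1)))
      (by rw [Function.comp_apply, gridPt_zero, hs_zero])
      (by rw [Function.comp_apply, gridPt_zero, ht_zero]) (n + 1) (IsFourierPair.of_memLp hf)
    simp only [Function.comp_apply, gridPt_self (Nat.succ_ne_zero n)] at h1
    refine h1.congr (Eventually.of_forall fun x => ?_) (Eventually.of_forall fun z => ?_)
    · simp only [weightedExpectation, additiveFunctional, ρ]
      congr 1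
      ext ω
      rw [setIntegral_comp_ceil_mul t ht ht_right (Nat.succ_ne_zero n)
        fun k => Ψ (x + X (s (gridPt (n + 1) (k - 1))) ω)]
      simp only [Nat.add_sub_cancel]
    · simp only [weightedExpectation, additiveFunctional, κ]
      congr 1
      ext ω
      rw [setIntegral_comp_ceil_mul s hs hs_right (Nat.succ_ne_zero n)
        fun k => Φ (z + (-Y) (t (gridPt (n + 1) k)) ω)]
      rfl
  have hF_mem : MemLp F 2 volume :=
    hF ▸ memLp_weightedExpectation hX.measurable hXc hΨc hΨ.re_nonneg hsm _ hf
  have hG_mem : MemLp G 2 volume :=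
    hG ▸ memLp_weightedExpectation hZm hZc hΦc hΦ.re_nonneg htm _ hg
  rw [← hF] at hF_lim
  rw [← hG] at hG_lim
  obtain ⟨h1, h2⟩ := IsFourierPair.of_tendsto hpair hF_mem hG_mem.1 hF_lim hG_lim
  exact ⟨h1, hG_mem, h2⟩
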